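/- **Setting.** Let $N=N_TQ$ with integers $N_T,Q\ge 1$. Let $\mathbf x=(x_1,\dots,x_N)$ be a proper (circularly symmetric) zero-mean complex Gaussian vector with covariance $K_{\mathbf x}=\mathbb E[\mathbf x\mathbf x^\dagger]$ of rank $s\ge 1$ and trace $P_x>0$, all of whose non-zero eigenvalues are equal: $K_{\mathbf x}=U_s\,(\tfrac{P_x}{s}I_s)\,U_s^\dagger$ with $U_s\in\mathbb C^{N\times s}$, $U_s^\dagger U_s=I_s$. Let $\mathbf w$ be a proper zero-mean complex Gaussian vector with covariance $\sigma_w^2I_N$, $\sigma_w^2>0$, independent of $\mathbf x$. Let $u_i\in\mathbb C^s$ be the $i$-th column of $U_s^\dagger$, $\eta_L=\min_i\|u_i\|^2$, $\eta_U=\max_i\|u_i\|^2$, and suppose $\eta_L>0$. The energy arrivals $E_1,\dots,E_N$ are i.i.d. real random variables, independent of $(\mathbf x,\mathbf w)$, with mean $\mu_E>0$ and variance $\varrho_E$, and $0\le E_t\le r_E\mu_E$ almost surely for a constant $r_E\ge1$. Time is divided into $N_T$ slots of $Q$ epochs. For $k=1,\dots,N_T$ put $\bar{\mathbf x}_k=(x_{(k-1)Q+1},\dots,x_{kQ})$,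 similarly $\bar{\mathbf w}_k$, and $\bar E_k=\sum_{t=1}^QE_{(k-1)Q+t}$. At the end of slot $k$ the buffer and the battery are emptied: the receiver obtains $\bar{\mathbf y}_k=\sqrt{p_k}\,\bar{\mathbf x}_k+\bar{\mathbf w}_k$, where $p_k\ge0$ is determined by $\mathbb E_S[\|\sqrt{p_k}\,\bar{\mathbf x}_k\|^2]=\bar E_k$. Here $\mathbb E_S$ is the expectation over $(\mathbf x,\mathbf w)$ for fixed energy arrivals. With $\mathbf y=(\bar{\mathbf y}_1,\dots,\bar{\mathbf y}_{N_T})$, let $$\varepsilon=\mathbb E_S\big[\|\mathbf x-\mathbb E_S[\mathbf x\mid\mathbf y]\|^2\big]$$ be the MMSE, a function of the energy arrivals; $\mathbb P$ denotes probability over the energy arrivals. Put $h(a)=(1+a)\log(1+a)-a$ for $a\ge 0$, and, for $\mu,r>0$, $$f_{bt}(\mu,\varrho,r)=2s\exp\Big(-\frac{\varrho}{\mu^2}h\Big(\frac{\mu r}{\varrho}\Big)\Big)\ (\varrho>0),\qquad f_{bt}(\mu,0,r)=\lim_{\varrho\downarrow0}f_{bt}(\mu,\varrho,r)=0,$$ $$f_{bn}(\mu,\varrho,r)=2s\exp\Big(-\frac{r^2/2}{\mu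 r/3+\varrho}\Big)\ (\varrho\ge0).$$ **Theorem.** *Bound I.* For every $r\in(0,1/\eta_U]$, $$\mathbb P(\varepsilon<\varepsilon_I)\ \ge\ 1-f_{bt}(\mu_I,\varrho_I,r)\ \ge\ 1-f_{bn}(\mu_I,\varrho_I,r),$$ where $$\varepsilon_I=\frac{P_x}{1+\frac{1}{\sigma_w^2}\mu_E\big(\frac1{\eta_U}-r\big)},\quad \mu_I=\frac1{\eta_L}\max\{r_E-1,1\}\min\{Q\eta_U,1\},\quad \varrho_I=\frac{\varrho_E}{\mu_E^2}\,\frac1{\eta_L^2}\,\frac1Q\min\{Q\eta_U,1\}.$$ *Bound II.* Let $\gamma\in(0,Qr_E]$ be such that $\bar p=\mathbb P(\bar E_k\ge\gamma\mu_E)$ (which does not depend on $k$) is positive. For every $r\in(0,1/\eta_U]$, $$\mathbb P(\varepsilon<\varepsilon_{II})\ \ge\ 1-f_{bt}(\mu_{II},\varrho_{II},r)\ \ge\ 1-f_{bn}(\mu_{II},\varrho_{II},r),$$ where $$\varepsilon_{II}=\frac{P_x}{1+\frac{1}{\sigma_w^2}\frac1Q\,\bar p\,\gamma\,\mu_E\big(\frac1{\eta_U}-r\big)},\quad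 \mu_{II}=\frac1{\eta_L}\max\Big\{\frac1{\bar p}-1,1\Big\}\min\{Q\eta_U,1\},\quad \varrho_{II}=\frac1{\eta_L^2}\Big(\frac1{\bar p}-1\Big)\min\{Q\eta_U,1\}.$$ -/

import Mathlib

open MeasureTheory ProbabilityTheory Matrix

namespace EnergyHarvesting

noncomputable section

/-! ### Signal model -/

/-- `z` is a proper (circularly symmetric) zero-mean complex Gaussian vector with covariance
`K = E[z zᴴ]`: it is jointly Gaussian (as a real vector), it has mean zero, covariance `K`, and
vanishing pseudo-covariance `E[z zᵀ] = 0`. -/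
structure IsProperComplexGaussian {Ω ι : Type*} [MeasurableSpace Ω] [Fintype ι]
    (P : Measure Ω) (z : Ω → EuclideanSpace ℂ ι) (K : Matrix ι ι ℂ) : Prop where
  measurable : Measurable z
  gaussian : HasGaussianLaw z P
  mean_eq_zero : ∀ i, ∫ ω, z ω i ∂P = 0
  covariance_eq : ∀ i j, ∫ ω, z ω i * star (z ω j) ∂P = K i j
  pseudoCovariance_eq : ∀ i j, ∫ ω, z ω i * z ω j ∂P = 0

/-- `K` has rank `s` and trace `Px`, and `K = U Λ Uᴴ` is a reduced eigenvalue decomposition in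
which all `s` non-zero eigenvalues are equal: `Uᴴ U = 1` and `Λ = (Px / s) • 1`. -/
structure IsFlatReducedEVD {ι : Type*} [Fintype ι] {s : ℕ}
    (K : Matrix ι ι ℂ) (U : Matrix ι (Fin s) ℂ) (Px : ℝ) : Prop where
  rank_eq : K.rank = s
  trace_eq : K.trace = (Px : ℂ)
  orthonormal : Uᴴ * U = 1
  decomposition : K = U * Matrix.diagonal (fun _ : Fin s => ((Px / s : ℝ) : ℂ)) * Uᴴ

/-- `u_i`, the `i`-th column of `Uᴴ`, as a Euclidean vector. -/
def uCol {ι : Type*} {s : ℕ} (U : Matrix ι (Fin s) ℂ) (i : ι) : EuclideanSpace ℂ (Fin s) :=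
  WithLp.toLp 2 (fun j => Uᴴ j i)

/-- `η_L = min_i ‖u_i‖²`. -/
def etaL {ι : Type*} {s : ℕ} (U : Matrix ι (Fin s) ℂ) : ℝ := ⨅ i, ‖uCol U i‖ ^ 2

/-- `η_U = max_i ‖u_i‖²`. -/
def etaU {ι : Type*} {s : ℕ} (U : Matrix ι (Fin s) ℂ) : ℝ := ⨆ i, ‖uCol U i‖ ^ 2

/-! ### The slotted block amplify-and-forward scheme

There are `NT` slots of `Q` epochs each. Epochs are indexed by `Fin (NT * Q)`; the `t`-th epoch of
slot `k` is `finProdFinEquiv (k, t) = t + Q * k`, and epoch `i` lies in slot `i.divNat = i / Q`. -/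

/-- Contents of the data buffer at the end of slot `k`. -/
def buffer {NT Q : ℕ} (x : EuclideanSpace ℂ (Fin (NT * Q))) (k : Fin NT) :
    EuclideanSpace ℂ (Fin Q) :=
  WithLp.toLp 2 (fun t => x (finProdFinEquiv (k, t)))

/-- Energy collected by the battery during slot `k`. -/
def slotEnergy {NT Q : ℕ} {Ω : Type*} (E : Fin (NT * Q) → Ω → ℝ) (k : Fin NT) (ω : Ω) : ℝ :=
  ∑ t : Fin Q, E (finProdFinEquiv (k, t)) ω

/-- Energy `J_k = E_S[‖√p x̄_k‖²]` spent in slot `k` with amplification factor `p` (slots have unit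
duration). -/
def txEnergy {NT Q : ℕ} {Ω : Type*} [MeasurableSpace Ω] (P : Measure Ω)
    (x : Ω → EuclideanSpace ℂ (Fin (NT * Q))) (p : ℝ) (k : Fin NT) : ℝ :=
  ∫ ω, ‖(Real.sqrt p : ℂ) • buffer (x ω) k‖ ^ 2 ∂P

/-- The received vector: `ȳ_k = √p_k x̄_k + w̄_k` in every slot `k`. -/
def received {NT Q : ℕ} {Ω : Type*} (p : Fin NT → ℝ)
    (x w : Ω → EuclideanSpace ℂ (Fin (NT * Q))) (ω : Ω) : EuclideanSpace ℂ (Fin (NT * Q)) :=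
  WithLp.toLp 2 (fun i => (Real.sqrt (p i.divNat) : ℂ) * x ω i + w ω i)

/-- The minimum mean-square error `E[‖x - E[x | y]‖²]`. -/
def mmse {Ω ι : Type*} [MeasurableSpace Ω] [Fintype ι] (P : Measure Ω)
    (x y : Ω → EuclideanSpace ℂ ι) : ℝ :=
  ∫ ω, ‖x ω - (P[x | MeasurableSpace.comap y inferInstance]) ω‖ ^ 2 ∂P

/-! ### The functions in the bounds -/

/-- `h(a) = (1 + a) log (1 + a) - a`. -/
def hfun (a : ℝ) : ℝ := (1 + a) * Real.log (1 + a) - a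

/-- `f_bt(μ, ϱ, r) = 2 s exp(-(ϱ / μ²) h(μ r / ϱ))`; at `ϱ = 0`, where this expression is
undefined, the value is its limit `0` as `ϱ` decreases to `0` (for `μ, r > 0`). -/
def fbt (s : ℕ) (μ ϱ r : ℝ) : ℝ :=
  if ϱ = 0 then 0 else 2 * s * Real.exp (-(ϱ / μ ^ 2) * hfun (μ * r / ϱ))

/-- `f_bn(μ, ϱ, r) = 2 s exp(-(r² / 2) / (μ r / 3 + ϱ))`. -/
def fbn (s : ℕ) (μ ϱ r : ℝ) : ℝ :=
  2 * s * Real.exp (-(r ^ 2 / 2) / (μ * r / 3 + ϱ))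

def errI (Px σw2 μE ηU r : ℝ) : ℝ := 1 / (1 + 1 / σw2 * μE * (1 / ηU - r)) * Px

def muI (Q : ℕ) (ηL ηU rE : ℝ) : ℝ := 1 / ηL * max (rE - 1) 1 * min (Q * ηU) 1

def rhoI (Q : ℕ) (ηL ηU μE ϱE : ℝ) : ℝ :=
  ϱE / μE ^ 2 * (1 / ηL ^ 2) * (1 / Q) * min (Q * ηU) 1

def errII (Q : ℕ) (Px σw2 μE ηU γ pbar r : ℝ) : ℝ :=
  1 / (1 + 1 / σw2 * (1 / Q) * pbar * γ * μE * (1 / ηU - r)) * Px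

def muII (Q : ℕ) (ηL ηU pbar : ℝ) : ℝ := 1 / ηL * max (1 / pbar - 1) 1 * min (Q * ηU) 1

def rhoII (Q : ℕ) (ηL ηU pbar : ℝ) : ℝ := 1 / ηL ^ 2 * (1 / pbar - 1) * min (Q * ηU) 1

end

end EnergyHarvesting

open EnergyHarvesting

/-!
The mean-square error is at most that of the Wiener filter, `(P_x / s) Re tr T⁻¹` with
`T = 1 + σ_w⁻² ∑ (Ē_k / Q) N_k`, where `N_k = (Q / ∑ ‖u_i‖²) ∑ u_i u_iᴴ` runs over the epochs of
slot `k`. If `Ē_k / Q ≥ a b_k` with `b_k` independent of mean one, then `∑ N_k ≥ 1 / η_U` shows that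
the error can exceed the bound only if `∑ (1 - b_k) N_k` has an eigenvalue of at least `r`. The
probability of this is controlled by a matrix Bennett inequality, obtained from the Golden–Thompson
inequality by averaging one summand of `tr exp(∑ ζ_k B_k)` at a time, following Oliveira.
Bound I takes `b_k = Ē_k / (Q μ_E)`, Bound II takes `b_k = 1[Ē_k ≥ γ μ_E] / p̄`.
-/

namespace EnergyHarvesting

section GoldenThompson

open NormedSpace Filter Topology

variable {𝕜 n : Type*} [RCLike 𝕜] [Fintype n]

theorem norm_trace_mul_sq_le (A B : Matrix n n 𝕜) :
    ‖trace (A * B)‖ ^ 2 ≤ RCLike.re (trace (Aᴴ * A)) * RCLike.re (trace (B * Bᴴ)) := by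
  have gram_left : RCLike.re (trace (Aᴴ * A)) = ∑ p : n × n, ‖A p.1 p.2‖ ^ 2 := by
    simp [trace, mul_apply, RCLike.conj_mul, Fintype.sum_prod_type_right]
  have gram_right : RCLike.re (trace (B * Bᴴ)) = ∑ p : n × n, ‖B p.2 p.1‖ ^ 2 := by
    simp [trace, mul_apply, RCLike.mul_conj, Fintype.sum_prod_type_right]
  rw [gram_left, gram_right]
  refine le_trans ?_ (Finset.sum_mul_sq_le_sq_mul_sq Finset.univ
    (fun p : n × n => ‖A p.1 p.2‖) (fun p => ‖B p.2 p.1‖))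
  gcongr
  simp only [trace, diag_apply, mul_apply]
  rw [← Fintype.sum_prod_type' (f := fun i j => A i j * B j i)]
  exact (norm_sum_le _ _).trans (by simp)

variable [DecidableEq n]

theorem trace_mul_pow_comm {R : Type*} [CommSemiring R] (X Y : Matrix n n R) (m : ℕ) :
    trace ((X * Y) ^ m) = trace ((Y * X) ^ m) := by
  cases m with
  | zero => simp
  | succ m =>
    have h : (X * Y) ^ (m + 1) = X * ((Y * X) ^ m * Y) := by
      induction m with
      | zero => simp
      | succ m ih => rw [pow_succ, ih, pow_succ]; simp only [Matrix.mul_assoc]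
    rw [h, trace_mul_comm, pow_succ, Matrix.mul_assoc]

theorem trace_gram_mul_pow {R : Type*} [CommSemiring R] [StarRing R] (A B : Matrix n n R)
    (m : ℕ) :
    trace (((A * B)ᴴ * (A * B)) ^ m) = trace ((Aᴴ * A * (B * Bᴴ)) ^ m) := by
  rw [conjTranspose_mul, Matrix.mul_assoc, trace_mul_pow_comm]
  simp only [Matrix.mul_assoc]

open scoped ComplexOrder in
theorem norm_trace_mul_self_pow_le {m : ℕ} {C : Matrix n n 𝕜}
    (h : ‖trace ((C * C) ^ m)‖ ^ 2 ≤
      RCLike.re (trace ((Cᴴ * C) ^ m)) * RCLike.re (trace ((C * Cᴴ) ^ m))) :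
    ‖trace ((C * C) ^ m)‖ ≤ RCLike.re (trace ((Cᴴ * C) ^ m)) := by
  have nonneg : 0 ≤ RCLike.re (trace ((Cᴴ * C) ^ m)) :=
    (RCLike.nonneg_iff.1 ((posSemidef_conjTranspose_mul_self C).pow m).trace_nonneg).1
  rw [trace_mul_pow_comm C Cᴴ, ← sq (RCLike.re _)] at h
  exact (abs_le_of_sq_le_sq h nonneg).trans' (le_abs_self _)

theorem norm_trace_mul_pow_sq_le (k : ℕ) (A B : Matrix n n 𝕜) :
    ‖trace ((A * B) ^ 2 ^ k)‖ ^ 2 ≤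
      RCLike.re (trace ((Aᴴ * A) ^ 2 ^ k)) * RCLike.re (trace ((B * Bᴴ) ^ 2 ^ k)) := by
  induction k generalizing A B with
  | zero => simpa using norm_trace_mul_sq_le A B
  | succ k ih =>
    have pow_two_mul (Z : Matrix n n 𝕜) : Z ^ 2 ^ (k + 1) = (Z * Z) ^ 2 ^ k := by
      rw [← sq, ← pow_mul, pow_succ']
    calc ‖trace ((A * B) ^ 2 ^ (k + 1))‖ ^ 2
        ≤ RCLike.re (trace (((A * B)ᴴ * (A * B)) ^ 2 ^ k)) ^ 2 := by
          rw [pow_two_mul]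
          gcongr
          exact norm_trace_mul_self_pow_le (ih _ _)
      _ ≤ ‖trace ((Aᴴ * A * (B * Bᴴ)) ^ 2 ^ k)‖ ^ 2 := by
          rw [trace_gram_mul_pow, ← sq_abs]
          gcongr
          exact RCLike.abs_re_le_norm _
      _ ≤ RCLike.re (trace ((Aᴴ * A) ^ 2 ^ (k + 1))) *
            RCLike.re (trace ((B * Bᴴ) ^ 2 ^ (k + 1))) := by
          simpa only [pow_two_mul, conjTranspose_mul, conjTranspose_conjTranspose] using
            ih (Aᴴ * A) (B * Bᴴ)

theorem norm_trace_mul_pow_two_pow_le (k : ℕ) {X Y : Matrix n n 𝕜} (hX : X.IsHermitian)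
    (hY : Y.IsHermitian) :
    ‖trace ((X * Y) ^ 2 ^ k)‖ ≤ ‖trace (X ^ 2 ^ k * Y ^ 2 ^ k)‖ := by
  induction k generalizing X Y with
  | zero => simp
  | succ k ih =>
    calc ‖trace ((X * Y) ^ 2 ^ (k + 1))‖
        ≤ RCLike.re (trace (((X * Y)ᴴ * (X * Y)) ^ 2 ^ k)) := by
          rw [pow_succ', pow_mul, sq (X * Y)]
          exact norm_trace_mul_self_pow_le (norm_trace_mul_pow_sq_le k _ _)
      _ ≤ ‖trace ((X ^ 2 * Y ^ 2) ^ 2 ^ k)‖ := by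
          rw [trace_gram_mul_pow, hX.eq, hY.eq, ← sq, ← sq]
          exact RCLike.re_le_norm _
      _ ≤ ‖trace (X ^ 2 ^ (k + 1) * Y ^ 2 ^ (k + 1))‖ := by
          simpa only [← pow_mul, ← pow_succ'] using ih (hX.pow 2) (hY.pow 2)

section LieProduct

variable {𝔸 : Type*} [NormedRing 𝔸]

theorem exp_inv_smul_pow [NormedAlgebra ℝ 𝔸] [CompleteSpace 𝔸] (Z : 𝔸) {m : ℕ} (hm : m ≠ 0) :
    exp ((m : ℝ)⁻¹ • Z) ^ m = exp Z := by
  have : NormedAlgebra ℚ 𝔸 := NormedAlgebra.restrictScalars ℚ ℝ 𝔸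
  rw [← NormedSpace.exp_nsmul, ← Nat.cast_smul_eq_nsmul ℝ, smul_smul,
    mul_inv_cancel₀ (Nat.cast_ne_zero.2 hm), one_smul]

variable [NormOneClass 𝔸]

theorem norm_pow_sub_pow_le {X Y : 𝔸} {K : ℝ} (hK : 1 ≤ K) (hX : ‖X‖ ≤ K) (hY : ‖Y‖ ≤ K)
    (m : ℕ) : ‖X ^ m - Y ^ m‖ ≤ m * K ^ m * ‖X - Y‖ := by
  induction m with
  | zero => simp
  | succ m ih =>
    have telescope : X ^ (m + 1) - Y ^ (m + 1) = X ^ m * (X - Y) + (X ^ m - Y ^ m) * Y := by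
      simp only [pow_succ]; noncomm_ring
    have head : ‖X ^ m * (X - Y)‖ ≤ K ^ (m + 1) * ‖X - Y‖ := by
      refine (norm_mul_le _ _).trans ?_
      gcongr
      exact ((norm_pow_le X m).trans (by gcongr)).trans (pow_le_pow_right₀ hK (Nat.le_succ m))
    have tail : ‖(X ^ m - Y ^ m) * Y‖ ≤ m * K ^ (m + 1) * ‖X - Y‖ :=
      calc ‖(X ^ m - Y ^ m) * Y‖ ≤ ‖X ^ m - Y ^ m‖ * ‖Y‖ := norm_mul_le _ _
        _ ≤ (m * K ^ m * ‖X - Y‖) * K := by gcongr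
        _ = m * K ^ (m + 1) * ‖X - Y‖ := by ring
    rw [telescope]
    refine (norm_add_le _ _).trans ((add_le_add head tail).trans_eq ?_)
    push_cast; ring

variable [NormedAlgebra ℝ 𝔸]

theorem norm_exp_le_exp_norm (a : 𝔸) : ‖exp a‖ ≤ Real.exp ‖a‖ := by
  rw [exp_eq_tsum ℝ, Real.exp_eq_exp_ℝ, exp_eq_tsum ℝ]
  refine tsum_of_norm_bounded (NormedSpace.expSeries_summable' (𝕂 := ℝ) ‖a‖).hasSum fun i => ?_
  rw [norm_smul, smul_eq_mul, norm_inv, RCLike.norm_natCast]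
  gcongr
  exact norm_pow_le a i

theorem norm_exp_mul_exp_pow_sub_exp_add_le [CompleteSpace 𝔸] (A B : 𝔸) {m : ℕ} (hm : m ≠ 0) :
    ‖(exp ((m : ℝ)⁻¹ • A) * exp ((m : ℝ)⁻¹ • B)) ^ m - exp (A + B)‖ ≤
      m * Real.exp (‖A‖ + ‖B‖) *
        ‖exp ((m : ℝ)⁻¹ • A) * exp ((m : ℝ)⁻¹ • B) - exp ((m : ℝ)⁻¹ • (A + B))‖ := by
  have norm_exp_inv_smul_le (Z : 𝔸) :
      ‖exp ((m : ℝ)⁻¹ • Z)‖ ≤ Real.exp ((m : ℝ)⁻¹ * ‖Z‖) :=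
    (norm_exp_le_exp_norm _).trans_eq (by rw [norm_smul, Real.norm_of_nonneg (by positivity)])
  rw [← exp_inv_smul_pow (A + B) hm]
  refine (norm_pow_sub_pow_le (K := Real.exp ((m : ℝ)⁻¹ * (‖A‖ + ‖B‖)))
    (Real.one_le_exp (by positivity)) ((norm_mul_le _ _).trans ?_)
    ((norm_exp_inv_smul_le _).trans ?_) m).trans_eq ?_
  · rw [mul_add, Real.exp_add]
    gcongr <;> exact norm_exp_inv_smul_le _
  · gcongr
    exact norm_add_le _ _
  · rw [← Real.exp_nat_mul, mul_inv_cancel_left₀ (Nat.cast_ne_zero.2 hm)]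

theorem tendsto_exp_mul_exp_pow [CompleteSpace 𝔸] (A B : 𝔸) :
    Tendsto (fun m : ℕ => (exp ((m : ℝ)⁻¹ • A) * exp ((m : ℝ)⁻¹ • B)) ^ m) atTop
      (𝓝 (exp (A + B))) := by
  let D : ℝ → 𝔸 := fun t => exp (t • A) * exp (t • B) - exp (t • (A + B))
  have hD : HasDerivAt D 0 0 := by
    refine (((hasDerivAt_exp_smul_const (𝕂 := ℝ) A 0).mul
      (hasDerivAt_exp_smul_const (𝕂 := ℝ) B 0)).sub
      (hasDerivAt_exp_smul_const (𝕂 := ℝ) (A + B) 0)).congr_deriv ?_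
    simp only [zero_smul, exp_zero, one_mul, mul_one, sub_self]
  have hinv : Tendsto (fun m : ℕ => (m : ℝ)⁻¹) atTop (𝓝[≠] 0) := by
    refine tendsto_nhdsWithin_iff.2 ⟨tendsto_inv_atTop_nhds_zero_nat, ?_⟩
    filter_upwards [eventually_ne_atTop 0] with m hm
    simpa using hm
  have hlim : Tendsto (fun m : ℕ => Real.exp (‖A‖ + ‖B‖) * ‖(m : ℝ) • D (m : ℝ)⁻¹‖) atTop
      (𝓝 0) := by
    have h := ((hasDerivAt_iff_tendsto_slope_zero.1 hD).comp hinv).norm.const_mul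
      (Real.exp (‖A‖ + ‖B‖))
    have hD0 : D 0 = 0 := by simp [D]
    simpa [Function.comp_def, hD0] using h
  rw [tendsto_iff_norm_sub_tendsto_zero]
  refine squeeze_zero' (Eventually.of_forall fun _ => norm_nonneg _) ?_ hlim
  filter_upwards [eventually_ne_atTop 0] with m hm
  refine (norm_exp_mul_exp_pow_sub_exp_add_le A B hm).trans_eq ?_
  rw [norm_smul, Real.norm_of_nonneg m.cast_nonneg, mul_comm (m : ℝ), mul_assoc]

end LieProduct

theorem continuous_matrix_exp : Continuous (exp : Matrix n n 𝕜 → Matrix n n 𝕜) := by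
  open scoped Norms.Operator in exact exp_continuous

theorem tendsto_matrix_exp_mul_exp_pow [Nonempty n] (A B : Matrix n n 𝕜) :
    Tendsto (fun m : ℕ => (exp ((m : ℝ)⁻¹ • A) * exp ((m : ℝ)⁻¹ • B)) ^ m) atTop
      (𝓝 (exp (A + B))) := by
  open scoped Norms.Operator in exact tendsto_exp_mul_exp_pow A B

theorem matrix_exp_inv_smul_pow (Z : Matrix n n 𝕜) {m : ℕ} (hm : m ≠ 0) :
    exp ((m : ℝ)⁻¹ • Z) ^ m = exp Z := by
  open scoped Norms.Operator in exact exp_inv_smul_pow Z hm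

theorem golden_thompson {A B : Matrix n n 𝕜} (hA : A.IsHermitian) (hB : B.IsHermitian) :
    ‖trace (exp (A + B))‖ ≤ ‖trace (exp A * exp B)‖ := by
  cases isEmpty_or_nonempty n with
  | inl h => simp [trace]
  | inr h =>
    have hlim := ((Continuous.matrix_trace continuous_id).norm.tendsto _).comp
      ((tendsto_matrix_exp_mul_exp_pow A B).comp (tendsto_pow_atTop_atTop_of_one_lt one_lt_two))
    refine le_of_tendsto' hlim fun k => ?_
    have isHermitian_exp {Z : Matrix n n 𝕜} (hZ : Z.IsHermitian) :
        (exp (((2 ^ k : ℕ) : ℝ)⁻¹ • Z)).IsHermitian := by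
      refine IsHermitian.exp ?_
      rw [IsHermitian, conjTranspose_smul, hZ.eq, star_trivial]
    have h := norm_trace_mul_pow_two_pow_le k (isHermitian_exp hA) (isHermitian_exp hB)
    rwa [matrix_exp_inv_smul_pow A (by positivity), matrix_exp_inv_smul_pow B (by positivity)] at h

end GoldenThompson

section FunctionalCalculus

open NormedSpace

open scoped ComplexOrder

variable {𝕜 n : Type*} [RCLike 𝕜] [Fintype n] [DecidableEq n] {A : Matrix n n 𝕜}

theorem trace_mul_cfc (hA : A.IsHermitian) (G : Matrix n n 𝕜) (f : ℝ → ℝ) :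
    trace (G * hA.cfc f) = ∑ i, f (hA.eigenvalues i) *
      ((hA.eigenvectorUnitary : Matrix n n 𝕜)ᴴ * G * hA.eigenvectorUnitary) i i := by
  rw [IsHermitian.cfc, Unitary.conjStarAlgAut_apply, ← Matrix.mul_assoc, trace_mul_comm,
    ← Matrix.mul_assoc, ← Matrix.mul_assoc, star_eq_conjTranspose]
  simp only [trace, diag_apply, mul_diagonal, Function.comp_apply]
  exact Finset.sum_congr rfl fun i _ => mul_comm _ _

theorem trace_cfc (hA : A.IsHermitian) (f : ℝ → ℝ) :
    trace (hA.cfc f) = ((∑ i, f (hA.eigenvalues i) : ℝ) : 𝕜) := by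
  have h := trace_mul_cfc hA 1 f
  rw [Matrix.one_mul, Matrix.mul_one, ← star_eq_conjTranspose, Unitary.coe_star_mul_self] at h
  simpa using h

theorem posSemidef_cfc_iff (hA : A.IsHermitian) (f : ℝ → ℝ) :
    (hA.cfc f).PosSemidef ↔ ∀ i, 0 ≤ f (hA.eigenvalues i) := by
  rw [IsHermitian.cfc, Unitary.conjStarAlgAut_apply,
    Matrix.IsUnit.posSemidef_star_right_conjugate_iff
      (IsUnit.of_mul_eq_one _ (Unitary.coe_mul_star_self _)), posSemidef_diagonal_iff]
  simp

theorem posDef_cfc_iff (hA : A.IsHermitian) (f : ℝ → ℝ) :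
    (hA.cfc f).PosDef ↔ ∀ i, 0 < f (hA.eigenvalues i) := by
  rw [IsHermitian.cfc, Unitary.conjStarAlgAut_apply,
    Matrix.IsUnit.posDef_star_right_conjugate_iff
      (IsUnit.of_mul_eq_one _ (Unitary.coe_mul_star_self _)), posDef_diagonal_iff]
  simp

theorem exp_cfc (hA : A.IsHermitian) (f : ℝ → ℝ) :
    exp (hA.cfc f) = hA.cfc (fun x => Real.exp (f x)) := by
  have inv_eq : (hA.eigenvectorUnitary : Matrix n n 𝕜)⁻¹ =
      star (hA.eigenvectorUnitary : Matrix n n 𝕜) :=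
    inv_eq_right_inv (Unitary.coe_mul_star_self _)
  simp only [IsHermitian.cfc, Unitary.conjStarAlgAut_apply, ← inv_eq]
  rw [exp_conj _ _ (IsUnit.of_mul_eq_one _ (Unitary.coe_mul_star_self _)), exp_diagonal]
  congr 3
  ext i
  rw [Pi.coe_exp, Function.comp_apply, Function.comp_apply, Real.exp_eq_exp_ℝ]
  exact (map_exp (algebraMap ℝ 𝕜) (continuous_algebraMap ℝ 𝕜) _).symm

theorem smul_one_sub_eq_cfc (hA : A.IsHermitian) (r : ℝ) :
    r • (1 : Matrix n n 𝕜) - A = hA.cfc (fun x => r - x) := by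
  rw [← hA.cfc_eq, cfc_sub (fun _ => r) (fun x => x) A, cfc_const r A, cfc_id' ℝ A,
    Algebra.algebraMap_eq_smul_one]

theorem posDef_smul_one_sub_iff (hA : A.IsHermitian) (r : ℝ) :
    (r • (1 : Matrix n n 𝕜) - A).PosDef ↔ ∀ i, hA.eigenvalues i < r := by
  simp only [smul_one_sub_eq_cfc hA, posDef_cfc_iff, sub_pos]

theorem posSemidef_smul_one_sub_iff (hA : A.IsHermitian) (r : ℝ) :
    (r • (1 : Matrix n n 𝕜) - A).PosSemidef ↔ ∀ i, hA.eigenvalues i ≤ r := by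
  simp only [smul_one_sub_eq_cfc hA, posSemidef_cfc_iff, sub_nonneg]

theorem posSemidef_exp (hA : A.IsHermitian) : (exp A).PosSemidef := by
  have h : A = hA.cfc (fun x => x) := by rw [← hA.cfc_eq, cfc_id' ℝ A]
  rw [h, exp_cfc, posSemidef_cfc_iff]
  exact fun i => (Real.exp_pos _).le

theorem norm_trace_exp_smul_eq_sum (hA : A.IsHermitian) (θ : ℝ) :
    ‖trace (exp (θ • A))‖ = ∑ i, Real.exp (θ * hA.eigenvalues i) := by
  have h : θ • A = hA.cfc (fun x => θ * x) := by rw [← hA.cfc_eq, cfc_const_mul_id θ A]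
  rw [h, exp_cfc, trace_cfc, RCLike.norm_of_nonneg (by positivity)]

theorem trace_inv_re_lt [Nonempty n] (hA : A.IsHermitian) {t : ℝ} (ht : 0 < t)
    (h : (A - t • (1 : Matrix n n 𝕜)).PosDef) :
    RCLike.re (trace A⁻¹) < Fintype.card n / t := by
  have sub_eq_cfc : A - t • (1 : Matrix n n 𝕜) = hA.cfc (fun x => x - t) := by
    rw [← hA.cfc_eq, cfc_sub (fun x => x) (fun _ => t) A, cfc_const t A, cfc_id' ℝ A,
      Algebra.algebraMap_eq_smul_one]
  rw [sub_eq_cfc, posDef_cfc_iff] at h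
  have eigenvalues_gt (i : n) : t < hA.eigenvalues i := sub_pos.1 (h i)
  have inv_eq_cfc : A⁻¹ = hA.cfc (fun x => x⁻¹) := by
    rw [← hA.cfc_eq, cfc_inv (fun x => x) A fun x hx => ?_, cfc_id' ℝ A,
      nonsing_inv_eq_ringInverse]
    rw [hA.spectrum_real_eq_range_eigenvalues] at hx
    obtain ⟨i, rfl⟩ := hx
    exact (ht.trans (eigenvalues_gt i)).ne'
  rw [inv_eq_cfc, trace_cfc, RCLike.ofReal_re, div_eq_mul_inv, ← nsmul_eq_mul,
    ← Finset.card_univ, ← Finset.sum_const]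
  exact Finset.sum_lt_sum_of_nonempty Finset.univ_nonempty fun i _ =>
    inv_strictAnti₀ ht (eigenvalues_gt i)

end FunctionalCalculus

section TraceMgf

open NormedSpace

open scoped ComplexOrder

variable {𝕜 n : Type*} [RCLike 𝕜]

theorem isHermitian_real_smul {A : Matrix n n 𝕜} (hA : A.IsHermitian) (a : ℝ) :
    (a • A).IsHermitian := by
  rw [IsHermitian, conjTranspose_smul, hA.eq, star_trivial]

theorem isHermitian_sum_smul {κ : Type*} (S : Finset κ) {B : κ → Matrix n n 𝕜}
    (hB : ∀ k, (B k).IsHermitian) (a : κ → ℝ) : (∑ k ∈ S, a k • B k).IsHermitian := by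
  rw [IsHermitian, conjTranspose_sum]
  exact Finset.sum_congr rfl fun k _ => isHermitian_real_smul (hB k) (a k)

variable [Fintype n] [DecidableEq n]

/-- The modulus of the `i`-th diagonal entry of `G` in the eigenbasis of the Hermitian matrix `B`.
It splits the trace of a positive semidefinite `G` along the eigenvectors of `B`. -/
noncomputable def eigenWeight {B : Matrix n n 𝕜} (hB : B.IsHermitian) (G : Matrix n n 𝕜)
    (i : n) : ℝ :=
  ‖((hB.eigenvectorUnitary : Matrix n n 𝕜)ᴴ * G * hB.eigenvectorUnitary) i i‖

theorem eigenWeight_nonneg {B : Matrix n n 𝕜} (hB : B.IsHermitian) (G : Matrix n n 𝕜) (i : n) :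
    0 ≤ eigenWeight hB G i :=
  norm_nonneg _

theorem continuous_eigenWeight {B : Matrix n n 𝕜} (hB : B.IsHermitian) (i : n) :
    Continuous fun G => eigenWeight hB G i :=
  (((continuous_const.matrix_mul continuous_id).matrix_mul continuous_const).matrix_elem i i).norm

theorem sum_eigenWeight {B G : Matrix n n 𝕜} (hB : B.IsHermitian) (hG : G.PosSemidef) :
    ∑ i, eigenWeight hB G i = ‖trace G‖ := by
  let V : Matrix n n 𝕜 := (hB.eigenvectorUnitary : Matrix n n 𝕜)
  have hV : V * Vᴴ = 1 := Unitary.coe_mul_star_self hB.eigenvectorUnitary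
  have trace_conj : trace (Vᴴ * G * V) = trace G := by
    rw [trace_mul_comm, ← Matrix.mul_assoc, hV, Matrix.one_mul]
  have diag_eq (i : n) : (Vᴴ * G * V) i i = (‖(Vᴴ * G * V) i i‖ : 𝕜) :=
    (RCLike.norm_of_nonneg' (hG.conjTranspose_mul_mul_same V).diag_nonneg).symm
  have trace_eq : trace (Vᴴ * G * V) = ((∑ i, eigenWeight hB G i : ℝ) : 𝕜) := by
    rw [RCLike.ofReal_sum]
    exact Finset.sum_congr rfl fun i _ => diag_eq i
  rw [← trace_conj, trace_eq,
    RCLike.norm_of_nonneg (Finset.sum_nonneg fun i _ => eigenWeight_nonneg hB G i)]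

/- Golden–Thompson is applied to the splitting `L + x B = (L + c B²) + (x B - c B²)`: the second
exponential commutes with `B`, so averaging over `x` only meets scalar moment
generating functions. -/
theorem norm_trace_exp_add_smul_le {L B : Matrix n n 𝕜} (hL : L.IsHermitian)
    (hB : B.IsHermitian) (x c : ℝ) :
    ‖trace (exp (L + x • B))‖ ≤
      ∑ i, Real.exp (x * hB.eigenvalues i - c * hB.eigenvalues i ^ 2) *
        eigenWeight hB (exp (L + c • B ^ 2)) i := by
  have hcfc : x • B - c • B ^ 2 = hB.cfc (fun d => x * d - c * d ^ 2) := by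
    rw [← hB.cfc_eq, cfc_sub (fun d => x * d) (fun d => c * d ^ 2) B, cfc_const_mul_id x B,
      cfc_const_mul c (fun d => d ^ 2) B, cfc_pow_id B 2]
  calc ‖trace (exp (L + x • B))‖ = ‖trace (exp (L + c • B ^ 2 + (x • B - c • B ^ 2)))‖ := by
        rw [add_add_sub_cancel]
    _ ≤ ‖trace (exp (L + c • B ^ 2) * exp (x • B - c • B ^ 2))‖ :=
        golden_thompson (hL.add (isHermitian_real_smul (hB.pow 2) c))
          ((isHermitian_real_smul hB x).sub (isHermitian_real_smul (hB.pow 2) c))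
    _ ≤ ∑ i, Real.exp (x * hB.eigenvalues i - c * hB.eigenvalues i ^ 2) *
          eigenWeight hB (exp (L + c • B ^ 2)) i := by
        rw [hcfc, exp_cfc, trace_mul_cfc]
        refine (norm_sum_le _ _).trans_eq (Finset.sum_congr rfl fun i _ => ?_)
        rw [norm_mul, RCLike.norm_of_nonneg (Real.exp_pos _).le]
        rfl

variable {Ω : Type*} [MeasurableSpace Ω] {P : Measure Ω}

theorem lintegral_trace_exp_add_smul_le {α : Type*} [TopologicalSpace α] [MeasurableSpace α]
    [OpensMeasurableSpace α] {Y : Ω → α} {ξ : Ω → ℝ} (hY : Measurable Y) (hξ : Measurable ξ)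
    (hind : IndepFun ξ Y P) {L : α → Matrix n n 𝕜} (hLcont : Continuous L)
    (hL : ∀ a, (L a).IsHermitian) {B : Matrix n n 𝕜} (hB : B.IsHermitian) {c : ℝ}
    (hmgf : ∀ i, ∫⁻ ω, ENNReal.ofReal
      (Real.exp (ξ ω * hB.eigenvalues i - c * hB.eigenvalues i ^ 2)) ∂P ≤ 1) :
    ∫⁻ ω, ENNReal.ofReal ‖trace (exp (L (Y ω) + ξ ω • B))‖ ∂P ≤
      ∫⁻ ω, ENNReal.ofReal ‖trace (exp (L (Y ω) + c • B ^ 2))‖ ∂P := by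
  let f (i : n) (x : ℝ) : ENNReal :=
    ENNReal.ofReal (Real.exp (x * hB.eigenvalues i - c * hB.eigenvalues i ^ 2))
  let g (i : n) (a : α) : ENNReal :=
    ENNReal.ofReal (eigenWeight hB (exp (L a + c • B ^ 2)) i)
  have hf (i : n) : Measurable (f i) := by fun_prop
  have hfξ (i : n) : Measurable fun ω => f i (ξ ω) := by fun_prop
  have hg (i : n) : Measurable (g i) :=
    (((continuous_eigenWeight hB i).comp
      (continuous_matrix_exp.comp (hLcont.add continuous_const))).measurable).ennreal_ofReal
  have hgY (i : n) : Measurable fun ω => g i (Y ω) := (hg i).comp hY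
  have posSemidef_exp_add (a : α) : (exp (L a + c • B ^ 2)).PosSemidef :=
    posSemidef_exp ((hL a).add (isHermitian_real_smul (hB.pow 2) c))
  calc ∫⁻ ω, ENNReal.ofReal ‖trace (exp (L (Y ω) + ξ ω • B))‖ ∂P
      ≤ ∫⁻ ω, ∑ i, f i (ξ ω) * g i (Y ω) ∂P := by
        refine lintegral_mono fun ω => ?_
        refine (ENNReal.ofReal_le_ofReal
          (norm_trace_exp_add_smul_le (hL (Y ω)) hB (ξ ω) c)).trans_eq ?_
        rw [ENNReal.ofReal_sum_of_nonneg
          fun i _ => mul_nonneg (Real.exp_pos _).le (eigenWeight_nonneg hB _ i)]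
        exact Finset.sum_congr rfl fun i _ => ENNReal.ofReal_mul (Real.exp_pos _).le
    _ = ∑ i, (∫⁻ ω, f i (ξ ω) ∂P) * ∫⁻ ω, g i (Y ω) ∂P := by
        refine (lintegral_finsetSum _ fun i _ => (hfξ i).mul (hgY i)).trans
          (Finset.sum_congr rfl fun i _ => ?_)
        exact lintegral_mul_eq_lintegral_mul_lintegral_of_indepFun (hfξ i) (hgY i)
          (hind.comp (hf i) (hg i))
    _ ≤ ∑ i, ∫⁻ ω, g i (Y ω) ∂P :=
        Finset.sum_le_sum fun i _ => mul_le_of_le_one_left' (hmgf i)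
    _ = ∫⁻ ω, ENNReal.ofReal ‖trace (exp (L (Y ω) + c • B ^ 2))‖ ∂P := by
        rw [← lintegral_finsetSum _ fun i _ => hgY i]
        refine lintegral_congr fun ω => ?_
        rw [← ENNReal.ofReal_sum_of_nonneg fun i _ => eigenWeight_nonneg hB _ i,
          sum_eigenWeight hB (posSemidef_exp_add (Y ω))]

theorem lintegral_trace_exp_sum_le [IsProbabilityMeasure P] {κ : Type*} {ξ : κ → Ω → ℝ}
    (hξ : ∀ k, Measurable (ξ k)) (hind : iIndepFun ξ P) {B : κ → Matrix n n 𝕜}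
    (hB : ∀ k, (B k).IsHermitian) (c : κ → ℝ)
    (hmgf : ∀ k i, ∫⁻ ω, ENNReal.ofReal
      (Real.exp (ξ k ω * (hB k).eigenvalues i - c k * (hB k).eigenvalues i ^ 2)) ∂P ≤ 1)
    (S : Finset κ) {H : Matrix n n 𝕜} (hH : H.IsHermitian) :
    ∫⁻ ω, ENNReal.ofReal ‖trace (exp (H + ∑ k ∈ S, ξ k ω • B k))‖ ∂P ≤
      ENNReal.ofReal ‖trace (exp (H + ∑ k ∈ S, c k • B k ^ 2))‖ := by
  classical
  induction S using Finset.induction_on generalizing H with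
  | empty => simp
  | insert k S hk ih =>
    let L : (S → ℝ) → Matrix n n 𝕜 := fun a => H + ∑ j : S, a j • B j
    have hLcont : Continuous L := by fun_prop
    have hL (a : S → ℝ) : (L a).IsHermitian :=
      hH.add (isHermitian_sum_smul _ (fun j : S => hB j) a)
    have L_apply (ω : Ω) : L (fun j => ξ j ω) = H + ∑ j ∈ S, ξ j ω • B j := by
      rw [← Finset.sum_coe_sort S fun j => ξ j ω • B j]
    have hindS : IndepFun (ξ k) (fun ω (j : S) => ξ j ω) P :=
      (hind.indepFun_finset {k} S (Finset.disjoint_singleton_left.2 hk) hξ).comp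
        (measurable_pi_apply (⟨k, Finset.mem_singleton_self k⟩ : ({k} : Finset κ)))
        measurable_id
    have remove_k := lintegral_trace_exp_add_smul_le
      (measurable_pi_lambda _ fun j : S => hξ j) (hξ k) hindS hLcont hL (hB k) (hmgf k)
    simp only [L_apply] at remove_k
    calc ∫⁻ ω, ENNReal.ofReal ‖trace (exp (H + ∑ j ∈ insert k S, ξ j ω • B j))‖ ∂P
        = ∫⁻ ω, ENNReal.ofReal ‖trace (exp (H + ∑ j ∈ S, ξ j ω • B j + ξ k ω • B k))‖ ∂P := by
          simp only [Finset.sum_insert hk, add_comm (ξ k _ • B k), add_assoc]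
      _ ≤ ∫⁻ ω, ENNReal.ofReal ‖trace (exp (H + c k • B k ^ 2 + ∑ j ∈ S, ξ j ω • B j))‖ ∂P := by
          simpa only [add_right_comm] using remove_k
      _ ≤ ENNReal.ofReal ‖trace (exp (H + ∑ j ∈ insert k S, c j • B j ^ 2))‖ := by
          rw [Finset.sum_insert hk, ← add_assoc]
          exact ih (hH.add (isHermitian_real_smul ((hB k).pow 2) (c k)))

end TraceMgf

section ScalarBennett

theorem sq_mul_exp_sub_le {x X : ℝ} (h : |x| ≤ X) :
    X ^ 2 * (Real.exp x - 1 - x) ≤ x ^ 2 * (Real.exp X - 1 - X) := by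
  have hasSum_remainder (y : ℝ) : HasSum (fun m : ℕ => y ^ (m + 2) / (m + 2).factorial)
      (Real.exp y - 1 - y) := by
    have hy := (hasSum_nat_add_iff' 2).2 (NormedSpace.expSeries_div_hasSum_exp (𝔸 := ℝ) y)
    simpa [Finset.sum_range_succ, sub_sub, Real.exp_eq_exp_ℝ] using hy
  refine hasSum_le (fun m => ?_) ((hasSum_remainder x).mul_left (X ^ 2))
    ((hasSum_remainder X).mul_left (x ^ 2))
  have pow_le : x ^ m ≤ X ^ m := (le_abs_self _).trans (by rw [abs_pow]; gcongr)
  calc X ^ 2 * (x ^ (m + 2) / (m + 2).factorial)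
      = X ^ 2 * x ^ 2 / (m + 2).factorial * x ^ m := by ring
    _ ≤ X ^ 2 * x ^ 2 / (m + 2).factorial * X ^ m := by gcongr
    _ = x ^ 2 * (X ^ (m + 2) / (m + 2).factorial) := by ring

/-- The coefficient `(e^{θR} - 1 - θR) / R²` of the variance in Bennett's bound on the moment
generating function at `θ` of a centred random variable bounded by `R`. -/
noncomputable def bennettCoeff (R θ : ℝ) : ℝ := (Real.exp (θ * R) - 1 - θ * R) / R ^ 2

theorem bennettCoeff_nonneg (R θ : ℝ) : 0 ≤ bennettCoeff R θ :=
  div_nonneg (by linarith [Real.add_one_le_exp (θ * R)]) (sq_nonneg R)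

theorem exp_mul_le_bennett {R θ y : ℝ} (hR : 0 < R) (hθ : 0 ≤ θ) (hy : |y| ≤ R) :
    Real.exp (θ * y) ≤ 1 + θ * y + bennettCoeff R θ * y ^ 2 := by
  have hθy : |θ * y| ≤ θ * R := by rw [abs_mul, abs_of_nonneg hθ]; gcongr
  rcases hθ.eq_or_lt with rfl | hθ
  · simp [bennettCoeff]
  have remainder_le : Real.exp (θ * y) - 1 - θ * y ≤ bennettCoeff R θ * y ^ 2 := by
    rw [bennettCoeff, div_mul_eq_mul_div, le_div_iff₀ (by positivity)]
    refine le_of_mul_le_mul_left ?_ (by positivity : 0 < θ ^ 2)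
    linarith [sq_mul_exp_sub_le hθy]
  linarith

variable {Ω : Type*} [MeasurableSpace Ω] {P : Measure Ω} [IsProbabilityMeasure P]

theorem mgf_le_exp_bennettCoeff_mul_variance {ζ : Ω → ℝ} {R θ : ℝ} (hζ : AEMeasurable ζ P)
    (hmean : P[ζ] = 0) (hR : 0 < R) (hθ : 0 ≤ θ) (hbd : ∀ᵐ ω ∂P, |ζ ω| ≤ R) :
    mgf ζ P θ ≤ Real.exp (bennettCoeff R θ * Var[ζ; P]) := by
  have hL2 : MemLp ζ 2 P := .of_bound hζ.aestronglyMeasurable R hbd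
  have hlin : Integrable (fun ω => 1 + θ * ζ ω) P :=
    (integrable_const 1).add ((hL2.integrable one_le_two).const_mul θ)
  have hquad : Integrable (fun ω => bennettCoeff R θ * ζ ω ^ 2) P :=
    hL2.integrable_sq.const_mul _
  calc mgf ζ P θ ≤ ∫ ω, (1 + θ * ζ ω + bennettCoeff R θ * ζ ω ^ 2) ∂P :=
        integral_mono_of_nonneg (.of_forall fun ω => (Real.exp_pos _).le) (hlin.add hquad)
          (hbd.mono fun ω hω => exp_mul_le_bennett hR hθ hω)
    _ = bennettCoeff R θ * Var[ζ; P] + 1 := by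
        rw [integral_add hlin hquad, integral_add (integrable_const 1)
          ((hL2.integrable one_le_two).const_mul θ), integral_const_mul, integral_const_mul,
          hmean, variance_of_integral_eq_zero hζ hmean]
        simp [add_comm]
    _ ≤ Real.exp (bennettCoeff R θ * Var[ζ; P]) := Real.add_one_le_exp _

theorem lintegral_exp_bennett_le_one {ζ : Ω → ℝ} {R θ l : ℝ} (hζ : AEMeasurable ζ P)
    (hmean : P[ζ] = 0) (hR : 0 < R) (hθ : 0 ≤ θ) (hbd : ∀ᵐ ω ∂P, |ζ ω * l| ≤ R) :
    ∫⁻ ω, ENNReal.ofReal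
      (Real.exp (θ * ζ ω * l - bennettCoeff R θ * Var[ζ; P] * l ^ 2)) ∂P ≤ 1 := by
  have hζl : AEMeasurable (fun ω => ζ ω * l) P := hζ.mul_const l
  have hmgf := mgf_le_exp_bennettCoeff_mul_variance hζl
    (by rw [integral_mul_const, hmean, zero_mul]) hR hθ hbd
  rw [variance_mul_const, ← mul_assoc] at hmgf
  have hint : Integrable (fun ω => Real.exp (θ * (ζ ω * l))) P :=
    integrable_exp_mul_of_mem_Icc hζl (hbd.mono fun ω hω => abs_le.1 hω)
  calc ∫⁻ ω, ENNReal.ofReal (Real.exp (θ * ζ ω * l - bennettCoeff R θ * Var[ζ; P] * l ^ 2)) ∂P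
      = ENNReal.ofReal (mgf (fun ω => ζ ω * l) P θ /
          Real.exp (bennettCoeff R θ * Var[ζ; P] * l ^ 2)) := by
        rw [mgf, ← integral_div, ofReal_integral_eq_lintegral_ofReal (hint.div_const _)
          (.of_forall fun ω => by positivity)]
        simp only [Real.exp_sub, mul_assoc]
    _ ≤ 1 := ENNReal.ofReal_le_one.2 (div_le_one_of_le₀ hmgf (Real.exp_pos _).le)

theorem exists_bennettCoeff_mul_sub_eq {μ ϱ r : ℝ} (hμ : 0 < μ) (hϱ : 0 < ϱ) (hr : 0 < r) :
    ∃ θ, 0 ≤ θ ∧ bennettCoeff μ θ * ϱ - θ * r = -(ϱ / μ ^ 2) * hfun (μ * r / ϱ) := by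
  have h_one_le : 1 ≤ 1 + μ * r / ϱ := le_add_of_nonneg_right (by positivity)
  refine ⟨Real.log (1 + μ * r / ϱ) / μ, div_nonneg (Real.log_nonneg h_one_le) hμ.le, ?_⟩
  rw [bennettCoeff, div_mul_cancel₀ _ hμ.ne', Real.exp_log (by linarith), hfun]
  field_simp
  ring

theorem le_half_fbt_of_forall_le {t : ENNReal} {s : ℕ} {μ ϱ r : ℝ} (hμ : 0 < μ) (hϱ : 0 ≤ ϱ)
    (hr : 0 < r)
    (h : ∀ θ, 0 ≤ θ → t ≤ ENNReal.ofReal (s * Real.exp (bennettCoeff μ θ * ϱ - θ * r))) :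
    t ≤ ENNReal.ofReal (fbt s μ ϱ r / 2) := by
  rcases hϱ.eq_or_lt with rfl | hϱ
  · have exp_tendsto : Filter.Tendsto (fun θ : ℝ => Real.exp (bennettCoeff μ θ * 0 - θ * r))
        Filter.atTop (nhds 0) := by
      simp only [mul_zero, zero_sub]
      exact Real.tendsto_exp_neg_atTop_nhds_zero.comp (Filter.tendsto_id.atTop_mul_const hr)
    have bound_tendsto := ENNReal.tendsto_ofReal (exp_tendsto.const_mul (s : ℝ))
    rw [mul_zero] at bound_tendsto
    rw [fbt, if_pos rfl, zero_div]
    exact ge_of_tendsto bound_tendsto ((Filter.eventually_ge_atTop 0).mono h)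
  · obtain ⟨θ, hθ, exponent_eq⟩ := exists_bennettCoeff_mul_sub_eq hμ hϱ hr
    have half_fbt_eq : s * Real.exp (bennettCoeff μ θ * ϱ - θ * r) = fbt s μ ϱ r / 2 := by
      rw [exponent_eq, fbt, if_neg hϱ.ne']
      ring
    exact half_fbt_eq ▸ h θ hθ

theorem sq_half_div_le_hfun {a : ℝ} (ha : 0 ≤ a) : a ^ 2 / 2 / (1 + a / 3) ≤ hfun a := by
  let F (x : ℝ) : ℝ := hfun x - x ^ 2 / 2 / (1 + x / 3)
  have hderiv (x : ℝ) (hx : 0 ≤ x) : HasDerivAt F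
      (Real.log (1 + x) - (x * (1 + x / 3) - x ^ 2 / 2 * (1 / 3)) / (1 + x / 3) ^ 2) x := by
    have hshift : HasDerivAt (fun x : ℝ => 1 + x) 1 x := (hasDerivAt_id x).const_add 1
    have hh := (hshift.mul (hshift.log (by linarith))).sub (hasDerivAt_id x)
    have hnum : HasDerivAt (fun x : ℝ => x ^ 2 / 2) x x :=
      (((hasDerivAt_id x).pow 2).div_const 2).congr_deriv (by simp)
    have hden : HasDerivAt (fun x : ℝ => 1 + x / 3) (1 / 3) x :=
      ((hasDerivAt_id x).div_const 3).const_add 1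
    refine (hh.sub (hnum.div hden (by positivity))).congr_deriv ?_
    have : 1 + x ≠ 0 := by positivity
    field_simp
    ring
  have deriv_nonneg (x : ℝ) (hx : 0 < x) : 0 ≤ deriv F x := by
    rw [(hderiv x hx.le).deriv, sub_nonneg]
    refine le_trans ?_ (Real.le_log_one_add_of_nonneg hx.le)
    rw [div_le_div_iff₀ (by positivity) (by positivity)]
    nlinarith [pow_pos hx 3]
  have hmono : MonotoneOn F (Set.Ici 0) := by
    refine monotoneOn_of_deriv_nonneg (convex_Ici 0)
      (fun x hx => (hderiv x hx).continuousAt.continuousWithinAt) ?_ ?_ <;>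
      rw [interior_Ici]
    · exact fun x hx => (hderiv x (le_of_lt hx)).differentiableAt.differentiableWithinAt
    · exact deriv_nonneg
  have F_zero : F 0 = 0 := by simp [F, hfun]
  exact sub_nonneg.1 (F_zero ▸ hmono Set.self_mem_Ici ha ha)

theorem fbt_le_fbn (s : ℕ) {μ ϱ r : ℝ} (hμ : 0 < μ) (hϱ : 0 ≤ ϱ) (hr : 0 < r) :
    fbt s μ ϱ r ≤ fbn s μ ϱ r := by
  unfold fbt fbn
  split_ifs with h
  · positivity
  have : 0 < ϱ := hϱ.lt_of_ne' h
  have exponent_le : r ^ 2 / 2 / (μ * r / 3 + ϱ) ≤ ϱ / μ ^ 2 * hfun (μ * r / ϱ) := by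
    calc r ^ 2 / 2 / (μ * r / 3 + ϱ)
        = ϱ / μ ^ 2 * ((μ * r / ϱ) ^ 2 / 2 / (1 + μ * r / ϱ / 3)) := by
          field_simp
          ring
      _ ≤ ϱ / μ ^ 2 * hfun (μ * r / ϱ) := by
          gcongr
          exact sq_half_div_le_hfun (by positivity)
  rw [neg_mul, neg_div]
  gcongr

end ScalarBennett

section MatrixBennett

open NormedSpace

open scoped ComplexOrder

variable {𝕜 n Ω : Type*} [RCLike 𝕜] [Fintype n] [DecidableEq n] [MeasurableSpace Ω]
  {P : Measure Ω}

theorem measure_not_posDef_smul_one_sub_le {X : Ω → Matrix n n 𝕜} (hX : ∀ ω, (X ω).IsHermitian)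
    {θ : ℝ} (hθ : 0 ≤ θ) (hmeas : Measurable fun ω => ‖trace (exp (θ • X ω))‖) (r : ℝ) :
    P {ω | ¬ (r • (1 : Matrix n n 𝕜) - X ω).PosDef} ≤
      ENNReal.ofReal (Real.exp (-(θ * r))) *
        ∫⁻ ω, ENNReal.ofReal ‖trace (exp (θ • X ω))‖ ∂P := by
  rw [← lintegral_const_mul _ hmeas.ennreal_ofReal]
  refine meas_le_lintegral₀ (hmeas.ennreal_ofReal.const_mul _).aemeasurable fun ω hω => ?_
  obtain ⟨i, hi⟩ : ∃ i, r ≤ (hX ω).eigenvalues i := by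
    simpa only [Set.mem_ofPred_eq, posDef_smul_one_sub_iff (hX ω), not_forall, not_lt] using hω
  have exp_le_trace : Real.exp (θ * r) ≤ ‖trace (exp (θ • X ω))‖ := by
    rw [norm_trace_exp_smul_eq_sum (hX ω)]
    calc Real.exp (θ * r) ≤ Real.exp (θ * (hX ω).eigenvalues i) := by gcongr
      _ ≤ ∑ j, Real.exp (θ * (hX ω).eigenvalues j) :=
          Finset.single_le_sum (f := fun j => Real.exp (θ * (hX ω).eigenvalues j))
            (fun j _ => (Real.exp_pos _).le) (Finset.mem_univ i)
  rw [← ENNReal.ofReal_mul (Real.exp_pos _).le, ENNReal.one_le_ofReal, Real.exp_neg]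
  exact (le_inv_mul_iff₀ (Real.exp_pos _)).2 (by rwa [mul_one])

theorem norm_trace_exp_smul_le {A : Matrix n n 𝕜} (hA : A.IsHermitian) {c ϱ : ℝ} (hc : 0 ≤ c)
    (hϱ : (ϱ • (1 : Matrix n n 𝕜) - A).PosSemidef) :
    ‖trace (exp (c • A))‖ ≤ Fintype.card n * Real.exp (c * ϱ) := by
  rw [norm_trace_exp_smul_eq_sum hA, ← nsmul_eq_mul, ← Finset.card_univ]
  refine Finset.sum_le_card_nsmul _ _ _ fun i _ => ?_
  gcongr
  exact (posSemidef_smul_one_sub_iff hA ϱ).1 hϱ i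

variable [IsProbabilityMeasure P] {κ : Type*} [Fintype κ] {ζ : κ → Ω → ℝ} {B : κ → Matrix n n 𝕜}

theorem measure_not_posDef_smul_one_sub_sum_le_exp (hζ : ∀ k, Measurable (ζ k))
    (hind : iIndepFun ζ P) (hmean : ∀ k, P[ζ k] = 0) (hB : ∀ k, (B k).IsHermitian) {R ϱ θ : ℝ}
    (hR : 0 < R) (hθ : 0 ≤ θ) (hbd : ∀ k i, ∀ᵐ ω ∂P, |ζ k ω * (hB k).eigenvalues i| ≤ R)
    (hϱ : (ϱ • (1 : Matrix n n 𝕜) - ∑ k, Var[ζ k; P] • B k ^ 2).PosSemidef) (r : ℝ) :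
    P {ω | ¬ (r • (1 : Matrix n n 𝕜) - ∑ k, ζ k ω • B k).PosDef} ≤
      ENNReal.ofReal (Fintype.card n * Real.exp (bennettCoeff R θ * ϱ - θ * r)) := by
  have hsq : (∑ k, Var[ζ k; P] • B k ^ 2).IsHermitian :=
    isHermitian_sum_smul _ (fun k => (hB k).pow 2) _
  have trace_mgf_le : ∫⁻ ω, ENNReal.ofReal ‖trace (exp (θ • ∑ k, ζ k ω • B k))‖ ∂P ≤
      ENNReal.ofReal ‖trace (exp (bennettCoeff R θ • ∑ k, Var[ζ k; P] • B k ^ 2))‖ := by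
    simpa only [zero_add, mul_smul, Finset.smul_sum] using
      lintegral_trace_exp_sum_le (ξ := fun k ω => θ * ζ k ω) (fun k => (hζ k).const_mul θ)
        (hind.comp (fun _ x => θ * x) fun _ => measurable_const_mul θ) hB
        (fun k => bennettCoeff R θ * Var[ζ k; P])
        (fun k i => lintegral_exp_bennett_le_one (hζ k).aemeasurable (hmean k) hR hθ (hbd k i))
        Finset.univ isHermitian_zero
  have trace_continuous : Continuous fun a : κ → ℝ => ‖trace (exp (θ • ∑ k, a k • B k))‖ :=
    (continuous_matrix_exp.comp (by fun_prop)).matrix_trace.norm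
  calc P {ω | ¬ (r • (1 : Matrix n n 𝕜) - ∑ k, ζ k ω • B k).PosDef}
      ≤ ENNReal.ofReal (Real.exp (-(θ * r))) *
          ∫⁻ ω, ENNReal.ofReal ‖trace (exp (θ • ∑ k, ζ k ω • B k))‖ ∂P :=
        measure_not_posDef_smul_one_sub_le (fun ω => isHermitian_sum_smul _ hB _) hθ
          (trace_continuous.measurable.comp (measurable_pi_lambda _ hζ)) r
    _ ≤ ENNReal.ofReal (Real.exp (-(θ * r))) *
          ENNReal.ofReal (Fintype.card n * Real.exp (bennettCoeff R θ * ϱ)) := by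
        gcongr
        exact trace_mgf_le.trans (ENNReal.ofReal_le_ofReal
          (norm_trace_exp_smul_le hsq (bennettCoeff_nonneg R θ) hϱ))
    _ = ENNReal.ofReal (Fintype.card n * Real.exp (bennettCoeff R θ * ϱ - θ * r)) := by
        rw [← ENNReal.ofReal_mul (Real.exp_pos _).le, sub_eq_add_neg, Real.exp_add]
        ring_nf

/- Only the upper tail is bounded, whence half of `fbt`, which carries the factor `2` of a two-sided
estimate. -/
theorem matrix_bennett (hζ : ∀ k, Measurable (ζ k)) (hind : iIndepFun ζ P)
    (hmean : ∀ k, P[ζ k] = 0) (hB : ∀ k, (B k).IsHermitian) {R ϱ r : ℝ} (hR : 0 < R)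
    (hbd : ∀ k i, ∀ᵐ ω ∂P, |ζ k ω * (hB k).eigenvalues i| ≤ R) (hϱ₀ : 0 ≤ ϱ)
    (hϱ : (ϱ • (1 : Matrix n n 𝕜) - ∑ k, Var[ζ k; P] • B k ^ 2).PosSemidef) (hr : 0 < r) :
    P {ω | ¬ (r • (1 : Matrix n n 𝕜) - ∑ k, ζ k ω • B k).PosDef} ≤
      ENNReal.ofReal (fbt (Fintype.card n) R ϱ r / 2) :=
  le_half_fbt_of_forall_le hR hϱ₀ hr fun _ hθ =>
    measure_not_posDef_smul_one_sub_sum_le_exp hζ hind hmean hB hR hθ hbd hϱ r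

end MatrixBennett

section ConditionalExpectation

variable {Ω F : Type*} {m m0 : MeasurableSpace Ω} [NormedAddCommGroup F] {μ : Measure Ω}

theorem norm_toLp_sq {f : Ω → F} (hf : MemLp f 2 μ) : ‖hf.toLp f‖ ^ 2 = ∫ ω, ‖f ω‖ ^ 2 ∂μ := by
  rw [Lp.norm_toLp, hf.eLpNorm_eq_integral_rpow_norm two_ne_zero ENNReal.ofNat_ne_top,
    ENNReal.toReal_ofReal (by positivity), ENNReal.toReal_ofNat, ← Real.rpow_natCast,
    ← Real.rpow_mul (by positivity)]
  norm_num

theorem integral_norm_sub_condExp_sq_le (𝕜 : Type*) [RCLike 𝕜] [InnerProductSpace 𝕜 F]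
    [NormedSpace ℝ F] [CompleteSpace F] [IsFiniteMeasure μ] (hm : m ≤ m0) {x g : Ω → F}
    (hx : MemLp x 2 μ) (hg : MemLp g 2 μ) (hgm : AEStronglyMeasurable[m] g μ) :
    ∫ ω, ‖x ω - (μ[x | m]) ω‖ ^ 2 ∂μ ≤ ∫ ω, ‖x ω - g ω‖ ^ 2 ∂μ := by
  have : Fact (m ≤ m0) := ⟨hm⟩
  have condExpL2_eq := hx.condExpL2_ae_eq_condExp (𝕜 := 𝕜) hm
  have hcond : MemLp (μ[x | m]) 2 μ := (Lp.memLp _).ae_eq condExpL2_eq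
  have toLp_condExp : hcond.toLp (μ[x | m]) = condExpL2 F 𝕜 hm (hx.toLp x) :=
    Lp.ext (hcond.coeFn_toLp.trans condExpL2_eq.symm)
  have toLp_mem : hg.toLp g ∈ lpMeas F 𝕜 m 2 μ :=
    mem_lpMeas_iff_aestronglyMeasurable.2 (hgm.congr hg.coeFn_toLp.symm)
  have norm_le : ‖hx.toLp x - hcond.toLp (μ[x | m])‖ ≤ ‖hx.toLp x - hg.toLp g‖ := by
    rw [toLp_condExp]
    refine ((lpMeas F 𝕜 m 2 μ).starProjection_minimal (hx.toLp x)).trans_le ?_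
    exact ciInf_le ⟨0, Set.forall_mem_range.2 fun _ => norm_nonneg _⟩
      (⟨hg.toLp g, toLp_mem⟩ : lpMeas F 𝕜 m 2 μ)
  rw [← MemLp.toLp_sub hx hcond, ← MemLp.toLp_sub hx hg] at norm_le
  simpa only [norm_toLp_sq, Pi.sub_apply] using pow_le_pow_left₀ (norm_nonneg _) norm_le 2

end ConditionalExpectation

section SecondOrder

variable {𝕜 Ω ι κ : Type*} [RCLike 𝕜] [MeasurableSpace Ω] {P : Measure Ω}

/-- The cross-correlation matrix `E[a bᴴ]` of two random vectors. -/
noncomputable def crossCorr (P : Measure Ω) (a : Ω → EuclideanSpace 𝕜 ι)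
    (b : Ω → EuclideanSpace 𝕜 κ) : Matrix ι κ 𝕜 :=
  of fun i j => ∫ ω, a ω i * star (b ω j) ∂P

theorem conjTranspose_crossCorr (a : Ω → EuclideanSpace 𝕜 ι) (b : Ω → EuclideanSpace 𝕜 κ) :
    (crossCorr P a b)ᴴ = crossCorr P b a := by
  ext i j
  simp only [crossCorr, conjTranspose_apply, of_apply, RCLike.star_def, ← integral_conj, map_mul,
    RCLike.conj_conj, mul_comm]

theorem crossCorr_eq_zero_of_indepFun {a : Ω → EuclideanSpace 𝕜 ι} {b : Ω → EuclideanSpace 𝕜 κ}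
    (ha : Measurable a) (hb : Measurable b) (hab : IndepFun a b P)
    (hmean : ∀ j, ∫ ω, b ω j ∂P = 0) : crossCorr P a b = 0 := by
  ext i j
  have hi : Measurable fun z : EuclideanSpace 𝕜 ι => z i := by fun_prop
  have hj : Measurable fun z : EuclideanSpace 𝕜 κ => star (z j) := by fun_prop
  have mean_star : ∫ ω, star (b ω j) ∂P = 0 :=
    integral_conj.trans (by rw [hmean, map_zero])
  calc ∫ ω, a ω i * star (b ω j) ∂P = (∫ ω, a ω i ∂P) * ∫ ω, star (b ω j) ∂P :=
        (hab.comp hi hj).integral_fun_mul_eq_mul_integral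
          (hi.comp ha).aestronglyMeasurable (hj.comp hb).aestronglyMeasurable
    _ = 0 := by rw [mean_star, mul_zero]

variable [Fintype ι] [Fintype κ]

theorem integrable_coord_mul_star {a : Ω → EuclideanSpace 𝕜 ι} {b : Ω → EuclideanSpace 𝕜 κ}
    (ha : MemLp a 2 P) (hb : MemLp b 2 P) (i : ι) (j : κ) :
    Integrable (fun ω => a ω i * star (b ω j)) P :=
  ((EuclideanSpace.proj i : EuclideanSpace 𝕜 ι →L[𝕜] 𝕜).comp_memLp' ha).integrable_mul
    ((EuclideanSpace.proj j : EuclideanSpace 𝕜 κ →L[𝕜] 𝕜).comp_memLp' hb).star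

theorem crossCorr_sub_left {a a' : Ω → EuclideanSpace 𝕜 ι} {b : Ω → EuclideanSpace 𝕜 κ}
    (ha : MemLp a 2 P) (ha' : MemLp a' 2 P) (hb : MemLp b 2 P) :
    crossCorr P (a - a') b = crossCorr P a b - crossCorr P a' b := by
  ext i j
  simp only [crossCorr, of_apply, Matrix.sub_apply, Pi.sub_apply, PiLp.sub_apply, sub_mul]
  exact integral_sub (integrable_coord_mul_star ha hb i j) (integrable_coord_mul_star ha' hb i j)

theorem crossCorr_sub_right {a : Ω → EuclideanSpace 𝕜 ι} {b b' : Ω → EuclideanSpace 𝕜 κ}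
    (ha : MemLp a 2 P) (hb : MemLp b 2 P) (hb' : MemLp b' 2 P) :
    crossCorr P a (b - b') = crossCorr P a b - crossCorr P a b' := by
  rw [← conjTranspose_crossCorr, crossCorr_sub_left hb hb' ha, conjTranspose_sub,
    conjTranspose_crossCorr, conjTranspose_crossCorr]

theorem trace_crossCorr_self {a : Ω → EuclideanSpace 𝕜 ι} (ha : MemLp a 2 P) :
    trace (crossCorr P a a) = ((∫ ω, ‖a ω‖ ^ 2 ∂P : ℝ) : 𝕜) := by
  rw [trace, ← integral_ofReal]
  simp only [EuclideanSpace.norm_sq_eq, RCLike.ofReal_sum, RCLike.ofReal_pow, ← RCLike.mul_conj]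
  exact (integral_finsetSum _ fun i _ => integrable_coord_mul_star ha ha i i).symm

variable [DecidableEq ι]

theorem memLp_toEuclideanCLM {a : Ω → EuclideanSpace 𝕜 ι} (ha : MemLp a 2 P) (M : Matrix ι ι 𝕜) :
    MemLp (fun ω => toEuclideanCLM (𝕜 := 𝕜) M (a ω)) 2 P :=
  (toEuclideanCLM (𝕜 := 𝕜) M).comp_memLp' ha

theorem crossCorr_toEuclideanCLM_left {a : Ω → EuclideanSpace 𝕜 ι} {b : Ω → EuclideanSpace 𝕜 κ}
    (ha : MemLp a 2 P) (hb : MemLp b 2 P) (M : Matrix ι ι 𝕜) :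
    crossCorr P (fun ω => toEuclideanCLM (𝕜 := 𝕜) M (a ω)) b = M * crossCorr P a b := by
  ext i j
  simp only [crossCorr, of_apply, mul_apply, ofLp_toEuclideanCLM, mulVec, dotProduct,
    Finset.sum_mul, mul_assoc, ← integral_const_mul]
  exact integral_finsetSum _ fun l _ => (integrable_coord_mul_star ha hb l j).const_mul _

theorem crossCorr_toEuclideanCLM_right {a : Ω → EuclideanSpace 𝕜 κ} {b : Ω → EuclideanSpace 𝕜 ι}
    (ha : MemLp a 2 P) (hb : MemLp b 2 P) (M : Matrix ι ι 𝕜) :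
    crossCorr P a (fun ω => toEuclideanCLM (𝕜 := 𝕜) M (b ω)) = crossCorr P a b * Mᴴ := by
  rw [← conjTranspose_crossCorr, crossCorr_toEuclideanCLM_left hb ha, conjTranspose_mul,
    conjTranspose_crossCorr]

end SecondOrder

section LinearEstimation

variable {𝕜 ι σ : Type*} [RCLike 𝕜] [Fintype ι] [Fintype σ] [DecidableEq σ]

/-- The matrix `1 + snr • Uᴴ Aᴴ A U`. When a signal with covariance `c • U Uᴴ` is observed through
`A` in white noise of power `q`, the linear MMSE is `c` times the trace of its inverse, with
`snr = c / q`. -/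
def informationMatrix (U : Matrix ι σ 𝕜) (A : Matrix ι ι 𝕜) (snr : ℝ) : Matrix σ σ 𝕜 :=
  1 + snr • (Uᴴ * (Aᴴ * A) * U)

/-- The linear MMSE estimator of a signal with covariance `c • U Uᴴ` from its observation through
`A` in white noise of power `q`, where `snr = c / q`. -/
noncomputable def wienerFilter (U : Matrix ι σ 𝕜) (A : Matrix ι ι 𝕜) (snr : ℝ) : Matrix ι ι 𝕜 :=
  snr • (U * (informationMatrix U A snr)⁻¹ * Uᴴ * Aᴴ)

open scoped ComplexOrder in
theorem isUnit_det_informationMatrix (U : Matrix ι σ 𝕜) (A : Matrix ι ι 𝕜) {snr : ℝ}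
    (hsnr : 0 ≤ snr) : IsUnit (informationMatrix U A snr).det := by
  have gram_posSemidef : (Uᴴ * (Aᴴ * A) * U).PosSemidef :=
    (posSemidef_conjTranspose_mul_self A).conjTranspose_mul_mul_same U
  exact (isUnit_iff_isUnit_det _).1
    (PosDef.one.add_posSemidef (gram_posSemidef.smul hsnr)).isUnit

variable [DecidableEq ι]

theorem one_sub_wienerFilter_mul_mul {U : Matrix ι σ 𝕜} {A : Matrix ι ι 𝕜} {snr : ℝ}
    (hT : IsUnit (informationMatrix U A snr).det) :
    (1 - wienerFilter U A snr * A) * U = U * (informationMatrix U A snr)⁻¹ := by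
  have filter_mul : wienerFilter U A snr * A * U =
      U * ((informationMatrix U A snr)⁻¹ * (informationMatrix U A snr - 1)) := by
    simp only [wienerFilter, informationMatrix, add_sub_cancel_left, Matrix.smul_mul,
      Matrix.mul_smul, Matrix.mul_assoc]
  rw [Matrix.sub_mul, filter_mul, Matrix.mul_sub, nonsing_inv_mul _ hT, Matrix.one_mul,
    Matrix.mul_one, Matrix.mul_sub, Matrix.mul_one, sub_sub_cancel]

/- With `M = 1 - L A` one has `M U = U T⁻¹`, so `L = snr • M U Uᴴ Aᴴ`: the noise term is
`c • M U Uᴴ (1 - M)ᴴ` and cancels all but the first half of the signal term. -/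
theorem wienerFilter_errorCovariance {U : Matrix ι σ 𝕜} {A : Matrix ι ι 𝕜} {c q : ℝ} (hq : q ≠ 0)
    (hT : IsUnit (informationMatrix U A (c / q)).det) :
    (1 - wienerFilter U A (c / q) * A) * (c • (U * Uᴴ)) * (1 - wienerFilter U A (c / q) * A)ᴴ +
        wienerFilter U A (c / q) * (q • (1 : Matrix ι ι 𝕜)) * (wienerFilter U A (c / q))ᴴ =
      c • (U * (informationMatrix U A (c / q))⁻¹ * Uᴴ) := by
  set L := wienerFilter U A (c / q) with hL
  have error_mul : (1 - L * A) * U = U * (informationMatrix U A (c / q))⁻¹ :=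
    one_sub_wienerFilter_mul_mul hT
  have noise_eq : L * (q • (1 : Matrix ι ι 𝕜)) = c • ((1 - L * A) * (U * Uᴴ) * Aᴴ) := by
    rw [Matrix.mul_smul, Matrix.mul_one, ← Matrix.mul_assoc (1 - L * A), error_mul, hL,
      wienerFilter, smul_smul, mul_div_cancel₀ _ hq]
  have noise_conj : Aᴴ * Lᴴ = 1 - (1 - L * A)ᴴ := by
    rw [conjTranspose_sub, conjTranspose_one, conjTranspose_mul, sub_sub_cancel]
  calc (1 - L * A) * (c • (U * Uᴴ)) * (1 - L * A)ᴴ + L * (q • (1 : Matrix ι ι 𝕜)) * Lᴴ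
      = c • ((1 - L * A) * (U * Uᴴ) * ((1 - L * A)ᴴ + Aᴴ * Lᴴ)) := by
        rw [noise_eq]
        simp only [Matrix.mul_smul, Matrix.smul_mul, Matrix.mul_add, smul_add, Matrix.mul_assoc]
    _ = c • (U * (informationMatrix U A (c / q))⁻¹ * Uᴴ) := by
        rw [noise_conj, add_sub_cancel, Matrix.mul_one, ← Matrix.mul_assoc, error_mul]

variable {Ω : Type*} [MeasurableSpace Ω] {P : Measure Ω}

/-- The second-order description of a signal `x` with covariance `c • U Uᴴ`, where `U` has
orthonormal columns, and of white noise `w` of power `q` uncorrelated with `x`. -/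
structure SecondOrderModel (P : Measure Ω) (x w : Ω → EuclideanSpace 𝕜 ι) (U : Matrix ι σ 𝕜)
    (c q : ℝ) : Prop where
  measurable_signal : Measurable x
  measurable_noise : Measurable w
  memLp_signal : MemLp x 2 P
  memLp_noise : MemLp w 2 P
  orthonormal : Uᴴ * U = 1
  corr_signal : crossCorr P x x = c • (U * Uᴴ)
  corr_noise : crossCorr P w w = q • (1 : Matrix ι ι 𝕜)
  corr_signal_noise : crossCorr P x w = 0

theorem SecondOrderModel.of_gaussian {s : ℕ} {x w : Ω → EuclideanSpace ℂ ι} {K : Matrix ι ι ℂ}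
    {U : Matrix ι (Fin s) ℂ} {Px q : ℝ} (hx : IsProperComplexGaussian P x K)
    (hw : IsProperComplexGaussian P w ((q : ℂ) • (1 : Matrix ι ι ℂ))) (hxw : IndepFun x w P)
    (hK : IsFlatReducedEVD K U Px) : SecondOrderModel P x w U (Px / s) q where
  measurable_signal := hx.measurable
  measurable_noise := hw.measurable
  memLp_signal := hx.gaussian.memLp_two
  memLp_noise := hw.gaussian.memLp_two
  orthonormal := hK.orthonormal
  corr_signal := by
    have hKU : K = (Px / s : ℝ) • (U * Uᴴ) := by
      rw [hK.decomposition, ← smul_one_eq_diagonal, Matrix.mul_smul, Matrix.mul_one,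
        Matrix.smul_mul, Complex.coe_smul]
    exact hKU ▸ ext fun i j => hx.covariance_eq i j
  corr_noise := by
    rw [← Complex.coe_smul]
    exact ext fun i j => hw.covariance_eq i j
  corr_signal_noise :=
    crossCorr_eq_zero_of_indepFun hx.measurable hw.measurable hxw hw.mean_eq_zero

theorem SecondOrderModel.crossCorr_error {x w : Ω → EuclideanSpace 𝕜 ι} {U : Matrix ι σ 𝕜}
    {c q : ℝ} (h : SecondOrderModel P x w U c q) (M L : Matrix ι ι 𝕜) :
    crossCorr P ((fun ω => toEuclideanCLM (𝕜 := 𝕜) M (x ω)) -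
        fun ω => toEuclideanCLM (𝕜 := 𝕜) L (w ω))
      ((fun ω => toEuclideanCLM (𝕜 := 𝕜) M (x ω)) -
        fun ω => toEuclideanCLM (𝕜 := 𝕜) L (w ω)) =
      M * (c • (U * Uᴴ)) * Mᴴ + L * (q • (1 : Matrix ι ι 𝕜)) * Lᴴ := by
  have hx := h.memLp_signal
  have hw := h.memLp_noise
  have hMx := memLp_toEuclideanCLM hx M
  have hLw := memLp_toEuclideanCLM hw L
  have corr_noise_signal : crossCorr P w x = 0 := by
    rw [← conjTranspose_crossCorr, h.corr_signal_noise, conjTranspose_zero]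
  rw [crossCorr_sub_left hMx hLw (hMx.sub hLw), crossCorr_sub_right hMx hMx hLw,
    crossCorr_sub_right hLw hMx hLw]
  simp only [crossCorr_toEuclideanCLM_left hx hMx, crossCorr_toEuclideanCLM_left hx hLw,
    crossCorr_toEuclideanCLM_left hw hMx, crossCorr_toEuclideanCLM_left hw hLw,
    crossCorr_toEuclideanCLM_right hx hx, crossCorr_toEuclideanCLM_right hx hw,
    crossCorr_toEuclideanCLM_right hw hx, crossCorr_toEuclideanCLM_right hw hw,
    h.corr_signal, h.corr_noise, h.corr_signal_noise, corr_noise_signal, Matrix.zero_mul,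
    Matrix.mul_zero, sub_zero, zero_sub, sub_neg_eq_add, Matrix.mul_assoc]

theorem SecondOrderModel.integral_norm_linear_error_sq {x w : Ω → EuclideanSpace 𝕜 ι}
    {U : Matrix ι σ 𝕜} {c q : ℝ} (h : SecondOrderModel P x w U c q) (A L : Matrix ι ι 𝕜) :
    ((∫ ω, ‖x ω - toEuclideanCLM (𝕜 := 𝕜) L (toEuclideanCLM (𝕜 := 𝕜) A (x ω) + w ω)‖ ^ 2 ∂P : ℝ) :
      𝕜) = trace ((1 - L * A) * (c • (U * Uᴴ)) * (1 - L * A)ᴴ +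
        L * (q • (1 : Matrix ι ι 𝕜)) * Lᴴ) := by
  have error_eq (ω : Ω) :
      x ω - toEuclideanCLM (𝕜 := 𝕜) L (toEuclideanCLM (𝕜 := 𝕜) A (x ω) + w ω) =
        toEuclideanCLM (𝕜 := 𝕜) (1 - L * A) (x ω) - toEuclideanCLM (𝕜 := 𝕜) L (w ω) := by
    rw [map_add, map_sub, map_one, map_mul, sub_add_eq_sub_sub]
    rfl
  have memLp_error : MemLp ((fun ω => toEuclideanCLM (𝕜 := 𝕜) (1 - L * A) (x ω)) -
      fun ω => toEuclideanCLM (𝕜 := 𝕜) L (w ω)) 2 P :=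
    (memLp_toEuclideanCLM h.memLp_signal _).sub (memLp_toEuclideanCLM h.memLp_noise _)
  rw [← h.crossCorr_error, trace_crossCorr_self memLp_error]
  simp only [error_eq, Pi.sub_apply]

theorem mmse_le_integral_norm_linear_error_sq [IsFiniteMeasure P] {x y : Ω → EuclideanSpace ℂ ι}
    (hx : MemLp x 2 P) (hy : MemLp y 2 P) (hym : Measurable y) (L : Matrix ι ι ℂ) :
    mmse P x y ≤ ∫ ω, ‖x ω - toEuclideanCLM (𝕜 := ℂ) L (y ω)‖ ^ 2 ∂P := by
  have estimate_measurable : StronglyMeasurable[MeasurableSpace.comap y inferInstance]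
      fun ω => toEuclideanCLM (𝕜 := ℂ) L (y ω) :=
    ((toEuclideanCLM (𝕜 := ℂ) L).continuous.measurable.comp
      (comap_measurable y)).stronglyMeasurable
  exact integral_norm_sub_condExp_sq_le ℂ hym.comap_le hx (memLp_toEuclideanCLM hy L)
    estimate_measurable.aestronglyMeasurable

theorem SecondOrderModel.mmse_le [IsFiniteMeasure P] {x w : Ω → EuclideanSpace ℂ ι}
    {U : Matrix ι σ ℂ} {c q : ℝ} (h : SecondOrderModel P x w U c q) (hc : 0 ≤ c) (hq : 0 < q)
    (A : Matrix ι ι ℂ) :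
    mmse P x (fun ω => toEuclideanCLM (𝕜 := ℂ) A (x ω) + w ω) ≤
      c * (trace (informationMatrix U A (c / q))⁻¹).re := by
  have measurable_obs : Measurable fun ω => toEuclideanCLM (𝕜 := ℂ) A (x ω) + w ω :=
    ((toEuclideanCLM (𝕜 := ℂ) A).continuous.measurable.comp h.measurable_signal).add
      h.measurable_noise
  have memLp_obs : MemLp (fun ω => toEuclideanCLM (𝕜 := ℂ) A (x ω) + w ω) 2 P :=
    (memLp_toEuclideanCLM h.memLp_signal A).add h.memLp_noise
  have hT : IsUnit (informationMatrix U A (c / q)).det :=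
    isUnit_det_informationMatrix U A (div_nonneg hc hq.le)
  have error_sq := h.integral_norm_linear_error_sq A (wienerFilter U A (c / q))
  rw [wienerFilter_errorCovariance hq.ne' hT, trace_smul, trace_mul_comm, ← Matrix.mul_assoc,
    h.orthonormal, Matrix.one_mul] at error_sq
  refine (mmse_le_integral_norm_linear_error_sq h.memLp_signal memLp_obs measurable_obs
    (wienerFilter U A (c / q))).trans_eq ?_
  simpa only [Complex.coe_algebraMap, Complex.ofReal_re, Complex.real_smul,
    Complex.re_ofReal_mul] using congrArg Complex.re error_sq

end LinearEstimation

section LoewnerOrder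

open scoped ComplexOrder

variable {𝕜 n : Type*} [RCLike 𝕜] [DecidableEq n] {G : Matrix n n 𝕜}

theorem posSemidef_smul_one_sub_mono {a b : ℝ} (h : (a • (1 : Matrix n n 𝕜) - G).PosSemidef)
    (hab : a ≤ b) : (b • (1 : Matrix n n 𝕜) - G).PosSemidef := by
  have split : b • (1 : Matrix n n 𝕜) - G = (a • 1 - G) + (b - a) • 1 := by module
  rw [split]
  exact h.add (PosSemidef.one.smul (sub_nonneg.2 hab))

variable [Fintype n]

theorem posSemidef_smul_sub_sq (hG : G.PosSemidef) {m : ℝ}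
    (h : (m • (1 : Matrix n n 𝕜) - G).PosSemidef) : (m • G - G ^ 2).PosSemidef := by
  have hH := hG.isHermitian
  have sub_eq_cfc : m • G - G ^ 2 = hH.cfc (fun d => m * d - d ^ 2) := by
    rw [← hH.cfc_eq, cfc_sub (fun d => m * d) (fun d => d ^ 2) G, cfc_const_mul_id m G,
      cfc_pow_id G 2]
  rw [sub_eq_cfc, posSemidef_cfc_iff]
  intro i
  have eigenvalue_le : hH.eigenvalues i ≤ m := (posSemidef_smul_one_sub_iff hH m).1 h i
  nlinarith [hG.eigenvalues_nonneg i]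

theorem posSemidef_smul_one_sub_of_trace_eq (hG : G.PosSemidef) {S : ℝ}
    (hS : trace G = (S : 𝕜)) : (S • (1 : Matrix n n 𝕜) - G).PosSemidef := by
  have sum_eigenvalues : S = ∑ i, hG.isHermitian.eigenvalues i := by
    rw [← RCLike.ofReal_inj (K := 𝕜), ← hS, hG.isHermitian.trace_eq_sum_eigenvalues,
      RCLike.ofReal_sum]
  rw [posSemidef_smul_one_sub_iff hG.isHermitian, sum_eigenvalues]
  exact fun i => Finset.single_le_sum (fun j _ => hG.eigenvalues_nonneg j) (Finset.mem_univ i)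

end LoewnerOrder

section SlotGram

open scoped ComplexOrder

variable {NT Q s : ℕ}

/-- The Gram matrix `∑ u_i u_iᴴ` over the epochs `i` of slot `k`. -/
noncomputable def slotGram (U : Matrix (Fin (NT * Q)) (Fin s) ℂ) (k : Fin NT) :
    Matrix (Fin s) (Fin s) ℂ :=
  Uᴴ * diagonal (fun i : Fin (NT * Q) => if i.divNat = k then (1 : ℂ) else 0) * U

/-- The total weight `∑ ‖u_i‖²` over the epochs `i` of slot `k`. -/
noncomputable def slotWeight (U : Matrix (Fin (NT * Q)) (Fin s) ℂ) (k : Fin NT) : ℝ :=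
  ∑ t : Fin Q, ‖uCol U (finProdFinEquiv (k, t))‖ ^ 2

/-- The slot Gram matrix normalized to trace `Q`. -/
noncomputable def normalizedSlotGram (U : Matrix (Fin (NT * Q)) (Fin s) ℂ) (k : Fin NT) :
    Matrix (Fin s) (Fin s) ℂ :=
  (Q / slotWeight U k) • slotGram U k

variable {U : Matrix (Fin (NT * Q)) (Fin s) ℂ}

theorem divNat_finProdFinEquiv (k : Fin NT) (t : Fin Q) :
    (finProdFinEquiv (k, t)).divNat = k :=
  congrArg Prod.fst (finProdFinEquiv.symm_apply_apply (k, t))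

theorem mul_conjTranspose_apply_self (i : Fin (NT * Q)) :
    (U * Uᴴ) i i = ((‖uCol U i‖ ^ 2 : ℝ) : ℂ) := by
  rw [EuclideanSpace.norm_sq_eq, mul_apply, Complex.ofReal_sum]
  refine Finset.sum_congr rfl fun j _ => ?_
  rw [uCol, conjTranspose_apply, RCLike.star_def, Complex.mul_conj', ← Complex.ofReal_pow]
  exact congrArg _ (congrArg (· ^ 2) (norm_star (U i j)).symm)

theorem posSemidef_slotGram (k : Fin NT) : (slotGram U k).PosSemidef := by
  refine (PosSemidef.diagonal fun i => ?_).conjTranspose_mul_mul_same U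
  dsimp only [Pi.zero_apply]
  split_ifs
  exacts [zero_le_one, le_rfl]

theorem trace_slotGram (k : Fin NT) : trace (slotGram U k) = (slotWeight U k : ℂ) := by
  rw [slotGram, Matrix.mul_assoc, trace_mul_comm, Matrix.mul_assoc, trace,
    ← finProdFinEquiv.sum_comp, Fintype.sum_prod_type, Finset.sum_eq_single k]
  · simp only [diag_apply, diagonal_mul, divNat_finProdFinEquiv, if_true, one_mul,
      mul_conjTranspose_apply_self, slotWeight, Complex.ofReal_sum]
  · intro j _ hj
    simp only [diag_apply, diagonal_mul, divNat_finProdFinEquiv, if_neg hj, zero_mul,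
      Finset.sum_const_zero]
  · simp only [Finset.mem_univ, not_true_eq_false, false_imp_iff]

theorem sum_smul_slotGram (p : Fin NT → ℝ) :
    ∑ k, p k • slotGram U k =
      Uᴴ * diagonal (fun i : Fin (NT * Q) => (p i.divNat : ℂ)) * U := by
  have diagonal_eq : diagonal (fun i : Fin (NT * Q) => (p i.divNat : ℂ)) = ∑ k, p k •
      diagonal (fun i : Fin (NT * Q) => if i.divNat = k then (1 : ℂ) else 0) := by
    ext i j
    by_cases hij : i = j
    · simp [hij, Matrix.sum_apply]
    · simp [hij, Matrix.sum_apply]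
  simp only [diagonal_eq, Matrix.mul_sum, Matrix.sum_mul, Matrix.mul_smul, Matrix.smul_mul,
    slotGram]

theorem sum_slotGram (hU : Uᴴ * U = 1) : ∑ k, slotGram U k = 1 := by
  simpa only [one_smul, Complex.ofReal_one, diagonal_one, Matrix.mul_one, hU] using
    sum_smul_slotGram (U := U) fun _ => 1

theorem etaL_le (i : Fin (NT * Q)) : etaL U ≤ ‖uCol U i‖ ^ 2 :=
  ciInf_le (Set.finite_range _).bddBelow i

theorem le_etaU (i : Fin (NT * Q)) : ‖uCol U i‖ ^ 2 ≤ etaU U :=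
  le_ciSup (f := fun i => ‖uCol U i‖ ^ 2) (Set.finite_range _).bddAbove i

theorem mul_etaL_le_slotWeight (k : Fin NT) : Q * etaL U ≤ slotWeight U k := by
  simpa [slotWeight] using Finset.card_nsmul_le_sum Finset.univ
    (fun t : Fin Q => ‖uCol U (finProdFinEquiv (k, t))‖ ^ 2) _ fun t _ => etaL_le _

theorem slotWeight_le_mul_etaU (k : Fin NT) : slotWeight U k ≤ Q * etaU U := by
  simpa [slotWeight] using Finset.sum_le_card_nsmul Finset.univ
    (fun t : Fin Q => ‖uCol U (finProdFinEquiv (k, t))‖ ^ 2) _ fun t _ => le_etaU _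

theorem nonempty_epoch (hη : 0 < etaL U) : Nonempty (Fin (NT * Q)) := by
  by_contra h
  rw [not_nonempty_iff] at h
  rw [etaL, Real.iInf_of_isEmpty] at hη
  exact hη.false

theorem nonempty_slot (hη : 0 < etaL U) : Nonempty (Fin NT) :=
  (nonempty_epoch hη).map Fin.divNat

theorem slotLength_pos (hη : 0 < etaL U) : (0 : ℝ) < Q := by
  obtain ⟨i⟩ := nonempty_epoch hη
  exact_mod_cast i.modNat.pos

theorem etaL_le_etaU (hη : 0 < etaL U) : etaL U ≤ etaU U :=
  have ⟨i⟩ := nonempty_epoch hη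
  (etaL_le i).trans (le_etaU i)

theorem etaU_pos (hη : 0 < etaL U) : 0 < etaU U :=
  hη.trans_le (etaL_le_etaU hη)

theorem nonempty_eigenvalueIndex (hη : 0 < etaL U) : Nonempty (Fin s) := by
  obtain ⟨i⟩ := nonempty_epoch hη
  have uCol_ne_zero : uCol U i ≠ 0 := by
    rw [← norm_ne_zero_iff, ← pow_ne_zero_iff two_ne_zero]
    exact (hη.trans_le (etaL_le i)).ne'
  by_contra h
  rw [not_nonempty_iff] at h
  exact uCol_ne_zero (Subsingleton.elim _ _)

theorem slotWeight_pos (hη : 0 < etaL U) (k : Fin NT) : 0 < slotWeight U k :=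
  (mul_pos (slotLength_pos hη) hη).trans_le (mul_etaL_le_slotWeight k)

theorem div_slotWeight_nonneg (hη : 0 < etaL U) (k : Fin NT) : 0 ≤ Q / slotWeight U k :=
  div_nonneg Q.cast_nonneg (slotWeight_pos hη k).le

theorem div_slotWeight_le (hη : 0 < etaL U) (k : Fin NT) : Q / slotWeight U k ≤ 1 / etaL U := by
  rw [div_le_div_iff₀ (slotWeight_pos hη k) hη, one_mul]
  exact mul_etaL_le_slotWeight k

theorem le_div_slotWeight (hη : 0 < etaL U) (k : Fin NT) : 1 / etaU U ≤ Q / slotWeight U k := by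
  rw [div_le_div_iff₀ (etaU_pos hη) (slotWeight_pos hη k), one_mul]
  exact slotWeight_le_mul_etaU k

theorem posSemidef_normalizedSlotGram (hη : 0 < etaL U) (k : Fin NT) :
    (normalizedSlotGram U k).PosSemidef :=
  (posSemidef_slotGram k).smul (div_slotWeight_nonneg hη k)

theorem posSemidef_sum_normalizedSlotGram_sub (hη : 0 < etaL U) (hU : Uᴴ * U = 1) :
    (∑ k, normalizedSlotGram U k - (1 / etaU U) • (1 : Matrix (Fin s) (Fin s) ℂ)).PosSemidef := by
  simp only [← sum_slotGram hU, Finset.smul_sum, ← Finset.sum_sub_distrib, normalizedSlotGram,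
    ← sub_smul]
  exact posSemidef_sum _ fun k _ =>
    (posSemidef_slotGram k).smul (sub_nonneg.2 (le_div_slotWeight hη k))

theorem posSemidef_min_smul_one_sub_slotGram (hU : Uᴴ * U = 1) (k : Fin NT) :
    (min (Q * etaU U) 1 • (1 : Matrix (Fin s) (Fin s) ℂ) - slotGram U k).PosSemidef := by
  rcases min_choice (Q * etaU U) 1 with h | h <;> rw [h]
  · exact posSemidef_smul_one_sub_mono
      (posSemidef_smul_one_sub_of_trace_eq (posSemidef_slotGram k) (trace_slotGram k))
      (slotWeight_le_mul_etaU k)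
  · rw [one_smul, ← sum_slotGram hU, ← Finset.sum_erase_eq_sub (Finset.mem_univ k)]
    exact posSemidef_sum _ fun j _ => posSemidef_slotGram j

theorem min_mul_etaU_pos (hη : 0 < etaL U) : 0 < min (Q * etaU U) 1 :=
  lt_min (mul_pos (slotLength_pos hη) (etaU_pos hη)) one_pos

theorem eigenvalues_normalizedSlotGram_le (hη : 0 < etaL U) (hU : Uᴴ * U = 1) (k : Fin NT)
    (i : Fin s) :
    (posSemidef_normalizedSlotGram hη k).isHermitian.eigenvalues i ≤
      1 / etaL U * min (Q * etaU U) 1 := by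
  have hN := (posSemidef_normalizedSlotGram hη k).isHermitian
  have sub_posSemidef : ((Q / slotWeight U k * min (Q * etaU U) 1) •
      (1 : Matrix (Fin s) (Fin s) ℂ) - normalizedSlotGram U k).PosSemidef := by
    rw [normalizedSlotGram, mul_smul, ← smul_sub]
    exact (posSemidef_min_smul_one_sub_slotGram hU k).smul (div_slotWeight_nonneg hη k)
  exact (posSemidef_smul_one_sub_iff hN _).1 (posSemidef_smul_one_sub_mono sub_posSemidef
    (mul_le_mul_of_nonneg_right (div_slotWeight_le hη k) (min_mul_etaU_pos hη).le)) i

/- Since `0 ≤ G_k ≤ m` gives `G_k² ≤ m G_k`, and `∑ G_k = 1`, no factor `NT` appears. -/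
theorem posSemidef_smul_one_sub_sum_sq (hη : 0 < etaL U) (hU : Uᴴ * U = 1) {v : ℝ} (hv : 0 ≤ v) :
    ((v * (1 / etaL U ^ 2) * min (Q * etaU U) 1) • (1 : Matrix (Fin s) (Fin s) ℂ) -
      ∑ k, v • normalizedSlotGram U k ^ 2).PosSemidef := by
  rw [← sum_slotGram hU, Finset.smul_sum, ← Finset.sum_sub_distrib]
  refine posSemidef_sum _ fun k _ => ?_
  have sq_le : (Q / slotWeight U k) ^ 2 ≤ 1 / etaL U ^ 2 := by
    rw [← _root_.one_div_pow]
    exact pow_le_pow_left₀ (div_slotWeight_nonneg hη k) (div_slotWeight_le hη k) 2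
  have split : (v * (1 / etaL U ^ 2) * min (Q * etaU U) 1) • slotGram U k -
      v • normalizedSlotGram U k ^ 2 =
      (v * (Q / slotWeight U k) ^ 2) •
          (min (Q * etaU U) 1 • slotGram U k - slotGram U k ^ 2) +
        (v * (1 / etaL U ^ 2 - (Q / slotWeight U k) ^ 2) * min (Q * etaU U) 1) •
          slotGram U k := by
    rw [normalizedSlotGram, smul_pow]
    module
  rw [split]
  exact ((posSemidef_smul_sub_sq (posSemidef_slotGram k)
    (posSemidef_min_smul_one_sub_slotGram hU k)).smul (by positivity)).add
    ((posSemidef_slotGram k).smul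
      (mul_nonneg (mul_nonneg hv (sub_nonneg.2 sq_le)) (min_mul_etaU_pos hη).le))

end SlotGram

section ErrorBound

open scoped ComplexOrder

variable {NT Q s : ℕ} {Ω : Type*}

theorem received_eq (p : Fin NT → ℝ) (x w : Ω → EuclideanSpace ℂ (Fin (NT * Q))) :
    received p x w = fun ω => toEuclideanCLM (𝕜 := ℂ)
      (diagonal fun i : Fin (NT * Q) => (√(p i.divNat) : ℂ)) (x ω) + w ω := by
  ext ω i
  simp [received, mulVec_diagonal]

variable [MeasurableSpace Ω] {P : Measure Ω}
  {x w : Ω → EuclideanSpace ℂ (Fin (NT * Q))} {U : Matrix (Fin (NT * Q)) (Fin s) ℂ} {c q : ℝ}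

theorem SecondOrderModel.integral_norm_coord_sq (h : SecondOrderModel P x w U c q)
    (i : Fin (NT * Q)) : ∫ ω, ‖x ω i‖ ^ 2 ∂P = c * ‖uCol U i‖ ^ 2 := by
  have hii := congrFun₂ h.corr_signal i i
  rw [Matrix.smul_apply, mul_conjTranspose_apply_self, crossCorr, of_apply,
    Complex.real_smul, ← Complex.ofReal_mul] at hii
  rw [← Complex.ofReal_inj, ← hii, ← integral_complex_ofReal]
  simp only [RCLike.star_def, Complex.mul_conj', Complex.ofReal_pow]

theorem SecondOrderModel.txEnergy_eq (h : SecondOrderModel P x w U c q) {p : ℝ} (hp : 0 ≤ p)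
    (k : Fin NT) : txEnergy P x p k = p * (c * slotWeight U k) := by
  have norm_buffer_sq (ω : Ω) : ‖(√p : ℂ) • buffer (x ω) k‖ ^ 2 =
      p * ∑ t : Fin Q, ‖x ω (finProdFinEquiv (k, t))‖ ^ 2 := by
    rw [norm_smul, mul_pow, Complex.norm_of_nonneg (Real.sqrt_nonneg p), Real.sq_sqrt hp,
      EuclideanSpace.norm_sq_eq]
    rfl
  have integrable_coord (i : Fin (NT * Q)) : Integrable (fun ω => ‖x ω i‖ ^ 2) P :=
    (h.memLp_signal.eval_piLp i).integrable_norm_pow two_ne_zero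
  simp only [txEnergy, norm_buffer_sq]
  rw [integral_const_mul, integral_finsetSum _ fun t _ => integrable_coord _]
  simp only [h.integral_norm_coord_sq, slotWeight, Finset.mul_sum]

/-- The information matrix of the received vector when slot `k` spends the energy `e k`; the
signal strength cancels, as the energy of a slot is proportional to its weight. -/
noncomputable def receivedInformation (U : Matrix (Fin (NT * Q)) (Fin s) ℂ) (q : ℝ)
    (e : Fin NT → ℝ) : Matrix (Fin s) (Fin s) ℂ :=
  1 + (1 / q) • ∑ k, (e k / Q) • normalizedSlotGram U k

theorem informationMatrix_diagonal_sqrt (hη : 0 < etaL U) {p e : Fin NT → ℝ}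
    (hp : ∀ k, 0 ≤ p k ∧ p k * (c * slotWeight U k) = e k) :
    informationMatrix U (diagonal fun i : Fin (NT * Q) => (√(p i.divNat) : ℂ)) (c / q) =
      receivedInformation U q e := by
  have amplification_gram : (diagonal fun i : Fin (NT * Q) => (√(p i.divNat) : ℂ))ᴴ *
      (diagonal fun i : Fin (NT * Q) => (√(p i.divNat) : ℂ)) =
      diagonal fun i : Fin (NT * Q) => (p i.divNat : ℂ) := by
    rw [diagonal_conjTranspose, diagonal_mul_diagonal]
    congr 1
    ext i
    rw [Pi.star_apply, RCLike.star_def, Complex.conj_ofReal, ← Complex.ofReal_mul,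
      Real.mul_self_sqrt (hp _).1]
  rw [informationMatrix, receivedInformation, amplification_gram, ← sum_smul_slotGram,
    Finset.smul_sum, Finset.smul_sum]
  congr 1
  refine Finset.sum_congr rfl fun k _ => ?_
  have hQ := (slotLength_pos hη).ne'
  have hk := (slotWeight_pos hη k).ne'
  rw [normalizedSlotGram, smul_smul, smul_smul, smul_smul, ← (hp k).2]
  congr 1
  field_simp

theorem SecondOrderModel.mmse_received_le [IsFiniteMeasure P] (h : SecondOrderModel P x w U c q)
    (hc : 0 ≤ c) (hq : 0 < q) (hη : 0 < etaL U) {p e : Fin NT → ℝ}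
    (hp : ∀ k, 0 ≤ p k ∧ txEnergy P x (p k) k = e k) :
    mmse P x (received p x w) ≤ c * (trace (receivedInformation U q e)⁻¹).re := by
  rw [received_eq, ← informationMatrix_diagonal_sqrt (c := c) hη fun k =>
    ⟨(hp k).1, (h.txEnergy_eq (hp k).1 k).symm.trans (hp k).2⟩]
  exact h.mmse_le hc hq _

theorem posDef_receivedInformation_sub (hq : 0 < q) (hη : 0 < etaL U) (hU : Uᴴ * U = 1)
    {e b : Fin NT → ℝ} {a r : ℝ} (ha : 0 < a) (heb : ∀ k, a * b k ≤ e k / Q)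
    (hb : (r • (1 : Matrix (Fin s) (Fin s) ℂ) -
      ∑ k, (1 - b k) • normalizedSlotGram U k).PosDef) :
    (receivedInformation U q e -
      (1 + 1 / q * a * (1 / etaU U - r)) • (1 : Matrix (Fin s) (Fin s) ℂ)).PosDef := by
  have split : receivedInformation U q e -
      (1 + 1 / q * a * (1 / etaU U - r)) • (1 : Matrix (Fin s) (Fin s) ℂ) =
      (1 / q) • (∑ k, (e k / Q - a * b k) • normalizedSlotGram U k +
        a • ((r • (1 : Matrix (Fin s) (Fin s) ℂ) -
            ∑ k, (1 - b k) • normalizedSlotGram U k) +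
          (∑ k, normalizedSlotGram U k - (1 / etaU U) • 1))) := by
    simp only [receivedInformation, sub_smul, one_smul, Finset.sum_sub_distrib, mul_smul,
      ← Finset.smul_sum]
    module
  rw [split]
  have slack_nonneg : (∑ k, (e k / Q - a * b k) • normalizedSlotGram U k).PosSemidef :=
    posSemidef_sum _ fun k _ =>
      (posSemidef_normalizedSlotGram hη k).smul (sub_nonneg.2 (heb k))
  have dominated_pos := hb.add_posSemidef (posSemidef_sum_normalizedSlotGram_sub hη hU)
  exact (PosDef.posSemidef_add slack_nonneg (dominated_pos.smul ha)).smul (one_div_pos.2 hq)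

theorem SecondOrderModel.mmse_received_lt [IsFiniteMeasure P] (h : SecondOrderModel P x w U c q)
    (hc : 0 < c) (hq : 0 < q) (hη : 0 < etaL U) {p e b : Fin NT → ℝ}
    (hp : ∀ k, 0 ≤ p k ∧ txEnergy P x (p k) k = e k) {a r : ℝ} (ha : 0 < a)
    (hr : r ≤ 1 / etaU U) (heb : ∀ k, a * b k ≤ e k / Q)
    (hb : (r • (1 : Matrix (Fin s) (Fin s) ℂ) -
      ∑ k, (1 - b k) • normalizedSlotGram U k).PosDef) :
    mmse P x (received p x w) < 1 / (1 + 1 / q * a * (1 / etaU U - r)) * (c * s) := by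
  have := nonempty_eigenvalueIndex hη
  have ht : 0 < 1 + 1 / q * a * (1 / etaU U - r) := by
    have := sub_nonneg.2 hr
    positivity
  have sub_posDef := posDef_receivedInformation_sub hq hη h.orthonormal ha heb hb
  have hT : (receivedInformation U q e).IsHermitian := by
    simpa only [sub_add_cancel] using
      sub_posDef.isHermitian.add ((PosDef.one (n := Fin s) (R := ℂ)).smul ht).isHermitian
  have trace_lt := trace_inv_re_lt hT ht sub_posDef
  rw [Fintype.card_fin] at trace_lt
  calc mmse P x (received p x w)
      ≤ c * (trace (receivedInformation U q e)⁻¹).re := h.mmse_received_le hc.le hq hη hp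
    _ < c * (s / (1 + 1 / q * a * (1 / etaU U - r))) := mul_lt_mul_of_pos_left trace_lt hc
    _ = 1 / (1 + 1 / q * a * (1 / etaU U - r)) * (c * s) := by ring

end ErrorBound

section UnitMean

variable {ι Ω : Type*} [MeasurableSpace Ω] {P : Measure Ω}

/-- Independent random variables of mean one and common variance `v` that deviate from their mean
by at most `R`: the normalized slot energies to which the matrix tail bound is applied. -/
structure IndepUnitMean (P : Measure Ω) (b : ι → Ω → ℝ) (v R : ℝ) : Prop where
  measurable : ∀ k, Measurable (b k)
  indep : iIndepFun b P
  integral_eq_one : ∀ k, P[b k] = 1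
  variance_eq : ∀ k, Var[b k; P] = v
  abs_one_sub_le : ∀ k, ∀ᵐ ω ∂P, |1 - b k ω| ≤ R

theorem indepUnitMean_indicator {β : Type*} [MeasurableSpace β] [IsProbabilityMeasure P]
    {X : ι → Ω → β} (hX : ∀ k, Measurable (X k)) (hind : iIndepFun X P) {S : Set β}
    (hS : MeasurableSet S) {π : ℝ} (hπ : ∀ k, P.real (X k ⁻¹' S) = π) (hπ₀ : 0 < π) :
    IndepUnitMean P (fun k ω => S.indicator (fun _ => 1 / π) (X k ω)) (1 / π - 1)
      (max (1 / π - 1) 1) := by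
  have measurable_indicator : Measurable (S.indicator fun _ => 1 / π) :=
    measurable_const.indicator hS
  have integral_indicator (k : ι) (a : ℝ) : ∫ ω, S.indicator (fun _ => a) (X k ω) ∂P = π * a := by
    rw [← hπ k]
    exact integral_indicator_const a (hX k hS)
  have integral_eq_one (k : ι) : ∫ ω, S.indicator (fun _ => 1 / π) (X k ω) ∂P = 1 := by
    rw [integral_indicator, mul_one_div_cancel hπ₀.ne']
  refine ⟨fun k => measurable_indicator.comp (hX k), hind.comp _ fun _ => measurable_indicator,
    integral_eq_one, fun k => ?_, fun k => ?_⟩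
  · have memLp_two : MemLp (fun ω => S.indicator (fun _ => 1 / π) (X k ω)) 2 P :=
      (memLp_const (1 / π)).indicator (hX k hS)
    have sq_eq : (fun ω => S.indicator (fun _ => 1 / π) (X k ω)) ^ 2 =
        fun ω => S.indicator (fun _ => (1 / π) ^ 2) (X k ω) := by
      ext ω
      by_cases hω : X k ω ∈ S <;> simp [hω]
    rw [variance_eq_sub memLp_two, sq_eq, integral_indicator, integral_eq_one]
    field_simp
  · refine Filter.Eventually.of_forall fun ω => ?_
    by_cases hω : X k ω ∈ S
    · have one_le : 1 ≤ 1 / π := (one_le_div hπ₀).2 (hπ k ▸ measureReal_le_one)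
      rw [Set.indicator_of_mem hω, abs_sub_comm, abs_of_nonneg (sub_nonneg.2 one_le)]
      exact le_max_left _ _
    · rw [Set.indicator_of_notMem hω, sub_zero, abs_one]
      exact le_max_right _ _

end UnitMean

section SlotEnergy

theorem iIndepFun_curry {ι Ω : Type*} {κ : ι → Type*} {β : (i : ι) → κ i → Type*}
    [MeasurableSpace Ω] {P : Measure Ω} [∀ i j, MeasurableSpace (β i j)]
    {X : (i : ι) → (j : κ i) → Ω → β i j} (hX : ∀ i j, Measurable (X i j))
    (h : iIndepFun (fun (p : Σ i, κ i) => X p.1 p.2) P) :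
    iIndepFun (fun i ω => (X i · ω)) P := by
  have := h.isProbabilityMeasure
  have (i : ι) (j : κ i) : IsProbabilityMeasure (P.map (X i j)) :=
    Measure.isProbabilityMeasure_map (hX i j).aemeasurable
  have indep_row (i : ι) : iIndepFun (X i) P := h.precomp (g := Sigma.mk i) sigma_mk_injective
  have curry_comp : MeasurableEquiv.piCurry β ∘ (fun ω (p : Σ i, κ i) => X p.1 p.2 ω) =
      fun ω i j => X i j ω := rfl
  rw [iIndepFun_iff_map_fun_eq_infinitePi_map (by fun_prop), ← curry_comp,
    ← Measure.map_map (by fun_prop) (by fun_prop), h.map_fun_eq_infinitePi_map (by fun_prop),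
    Measure.infinitePi_map_piCurry (fun i j => P.map (X i j))]
  exact congrArg _ (funext fun i => ((indep_row i).map_fun_eq_infinitePi_map (hX i)).symm)

variable {NT Q : ℕ} {Ω : Type*} {E : Fin (NT * Q) → Ω → ℝ}

theorem epoch_injective (k : Fin NT) :
    Function.Injective fun t : Fin Q => finProdFinEquiv (k, t) :=
  finProdFinEquiv.injective.comp (Prod.mk_right_injective k)

theorem slotEnergy_mem_Icc {B : ℝ} {ω : Ω} (hE : ∀ t, E t ω ∈ Set.Icc 0 B) (k : Fin NT) :
    slotEnergy E k ω ∈ Set.Icc 0 (Q * B) := by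
  refine ⟨Finset.sum_nonneg fun t _ => (hE _).1, ?_⟩
  simpa [slotEnergy] using Finset.sum_le_card_nsmul Finset.univ
    (fun t : Fin Q => E (finProdFinEquiv (k, t)) ω) _ fun t _ => (hE _).2

variable [MeasurableSpace Ω] {P : Measure Ω}

theorem measurable_slotEnergy (hE : ∀ t, Measurable (E t)) (k : Fin NT) :
    Measurable (slotEnergy E k) :=
  Finset.measurable_fun_sum _ fun _ _ => hE _

theorem iIndepFun_slotEnergy (hE : ∀ t, Measurable (E t)) (hind : iIndepFun E P) :
    iIndepFun (slotEnergy (NT := NT) E) P := by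
  have epochs_injective : Function.Injective
      fun p : Σ _ : Fin NT, Fin Q => finProdFinEquiv (p.1, p.2) :=
    finProdFinEquiv.injective.comp (Equiv.sigmaEquivProd (Fin NT) (Fin Q)).injective
  have indep_blocks := iIndepFun_curry (X := fun k t => E (finProdFinEquiv (k, t)))
    (fun _ _ => hE _) (hind.precomp epochs_injective)
  exact indep_blocks.comp (fun _ a => ∑ t : Fin Q, a t) fun _ => by fun_prop

theorem identDistrib_slotEnergy (hind : iIndepFun E P)
    (hid : ∀ t t', IdentDistrib (E t) (E t') P P) (k k' : Fin NT) :
    IdentDistrib (slotEnergy E k) (slotEnergy E k') P P :=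
  (IdentDistrib.pi (fun t : Fin Q => hid (finProdFinEquiv (k, t)) (finProdFinEquiv (k', t)))
    (hind.precomp (epoch_injective k)) (hind.precomp (epoch_injective k'))).comp
    (u := fun a : Fin Q → ℝ => ∑ t, a t) (by fun_prop)

theorem integral_slotEnergy (hint : ∀ t, Integrable (E t) P) {μE : ℝ}
    (hmean : ∀ t, ∫ ω, E t ω ∂P = μE) (k : Fin NT) : ∫ ω, slotEnergy E k ω ∂P = Q * μE := by
  simp only [slotEnergy]
  rw [integral_finsetSum _ fun t _ => hint _]
  simp [hmean]

theorem variance_slotEnergy (hL2 : ∀ t, MemLp (E t) 2 P) (hind : iIndepFun E P) {ϱE : ℝ}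
    (hvar : ∀ t, Var[E t; P] = ϱE) (k : Fin NT) : Var[slotEnergy E k; P] = Q * ϱE := by
  have slotEnergy_eq : slotEnergy E k = ∑ t : Fin Q, E (finProdFinEquiv (k, t)) := by
    ext ω
    simp [slotEnergy]
  rw [slotEnergy_eq, IndepFun.variance_sum (fun t _ => hL2 _)
    fun t _ t' _ htt' => hind.indepFun ((epoch_injective k).ne htt')]
  simp [hvar]

theorem indepUnitMean_slotEnergy (hQ : (0 : ℝ) < Q) (hE : ∀ t, Measurable (E t))
    (hind : iIndepFun E P) {μE ϱE rE : ℝ} (hμE : 0 < μE) (hmean : ∀ t, ∫ ω, E t ω ∂P = μE)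
    (hvar : ∀ t, Var[E t; P] = ϱE) (hbd : ∀ t, ∀ᵐ ω ∂P, 0 ≤ E t ω ∧ E t ω ≤ rE * μE) :
    IndepUnitMean P (fun (k : Fin NT) ω => (Q * μE)⁻¹ * slotEnergy E k ω)
      (ϱE / μE ^ 2 * (1 / Q)) (max (rE - 1) 1) := by
  have := hind.isProbabilityMeasure
  have hQμ : 0 < Q * μE := mul_pos hQ hμE
  have memLp_arrival (t : Fin (NT * Q)) : MemLp (E t) 2 P :=
    MemLp.of_bound (hE t).aestronglyMeasurable (rE * μE) ((hbd t).mono fun ω h => by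
      rw [Real.norm_of_nonneg h.1]
      exact h.2)
  refine ⟨fun k => (measurable_slotEnergy hE k).const_mul _,
    (iIndepFun_slotEnergy hE hind).comp _ fun _ => measurable_const_mul _, fun k => ?_,
    fun k => ?_, fun k => ?_⟩
  · rw [integral_const_mul,
      integral_slotEnergy (fun t => (memLp_arrival t).integrable one_le_two) hmean,
      inv_mul_cancel₀ hQμ.ne']
  · rw [variance_const_mul, variance_slotEnergy memLp_arrival hind hvar]
    field_simp
  · filter_upwards [ae_all_iff.2 hbd] with ω hω
    have ⟨slot_nonneg, slot_le⟩ := slotEnergy_mem_Icc hω k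
    have normalized_nonneg : 0 ≤ (Q * μE)⁻¹ * slotEnergy E k ω := by positivity
    have normalized_le : (Q * μE)⁻¹ * slotEnergy E k ω ≤ rE := by
      rw [inv_mul_le_iff₀ hQμ]
      linarith
    rw [abs_le]
    constructor <;> linarith [le_max_left (rE - 1) 1, le_max_right (rE - 1) 1]

end SlotEnergy

section TailBound

open scoped ComplexOrder

variable {NT Q s : ℕ} {U : Matrix (Fin (NT * Q)) (Fin s) ℂ}

/-- The bound on the eigenvalues of `(1 - b_k) N_k` for `|1 - b_k| ≤ R`, where `N_k` is the
normalized Gram matrix of slot `k`. -/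
noncomputable def deviationBound (U : Matrix (Fin (NT * Q)) (Fin s) ℂ) (R : ℝ) : ℝ :=
  1 / etaL U * R * min (Q * etaU U) 1

/-- The bound on the matrix variance of `∑ (1 - b_k) N_k` for `b_k` of variance `v`, where `N_k` is
the normalized Gram matrix of slot `k`. -/
noncomputable def deviationVariance (U : Matrix (Fin (NT * Q)) (Fin s) ℂ) (v : ℝ) : ℝ :=
  v * (1 / etaL U ^ 2) * min (Q * etaU U) 1

theorem deviationBound_pos (hη : 0 < etaL U) {R : ℝ} (hR : 0 < R) : 0 < deviationBound U R :=
  mul_pos (mul_pos (one_div_pos.2 hη) hR) (min_mul_etaU_pos hη)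

theorem deviationVariance_nonneg (hη : 0 < etaL U) {v : ℝ} (hv : 0 ≤ v) :
    0 ≤ deviationVariance U v :=
  mul_nonneg (mul_nonneg hv (by positivity)) (min_mul_etaU_pos hη).le

variable {ΩE : Type*} [MeasurableSpace ΩE] {PE : Measure ΩE}
  {b : Fin NT → ΩE → ℝ} {v R r : ℝ}

theorem IndepUnitMean.variance_nonneg (hb : IndepUnitMean PE b v R) (hη : 0 < etaL U) : 0 ≤ v :=
  have ⟨k⟩ := nonempty_slot hη
  hb.variance_eq k ▸ ProbabilityTheory.variance_nonneg _ _

variable [IsProbabilityMeasure PE]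

theorem IndepUnitMean.integral_one_sub (hb : IndepUnitMean PE b v R) (k : Fin NT) :
    ∫ ω, (1 - b k ω) ∂PE = 0 := by
  have integrable : Integrable (b k) PE :=
    .of_integral_ne_zero (hb.integral_eq_one k ▸ one_ne_zero)
  rw [integral_sub (integrable_const _) integrable, hb.integral_eq_one, integral_const,
    probReal_univ, one_smul, sub_self]

theorem IndepUnitMean.measure_not_posDef_le (hb : IndepUnitMean PE b v R) (hη : 0 < etaL U)
    (hU : Uᴴ * U = 1) (hR : 0 < R) (hr : 0 < r) :
    PE {ω | ¬ (r • (1 : Matrix (Fin s) (Fin s) ℂ) -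
      ∑ k, (1 - b k ω) • normalizedSlotGram U k).PosDef} ≤
      ENNReal.ofReal (fbt s (deviationBound U R) (deviationVariance U v) r / 2) := by
  have hv := hb.variance_nonneg hη
  have eigenvalue_le (k : Fin NT) (i : Fin s) : ∀ᵐ ω ∂PE, |(1 - b k ω) *
      (posSemidef_normalizedSlotGram hη k).isHermitian.eigenvalues i| ≤ deviationBound U R := by
    have eigenvalue_nonneg := (posSemidef_normalizedSlotGram hη k).eigenvalues_nonneg i
    filter_upwards [hb.abs_one_sub_le k] with ω hω
    rw [abs_mul, abs_of_nonneg eigenvalue_nonneg, deviationBound, mul_comm (1 / etaL U), mul_assoc]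
    exact mul_le_mul hω (eigenvalues_normalizedSlotGram_le hη hU k i) eigenvalue_nonneg hR.le
  have variance_one_sub (k : Fin NT) : Var[fun ω => 1 - b k ω; PE] = v := by
    rw [variance_const_sub (hb.measurable k).aestronglyMeasurable, hb.variance_eq]
  have variance_le : (deviationVariance U v • (1 : Matrix (Fin s) (Fin s) ℂ) -
      ∑ k, Var[fun ω => 1 - b k ω; PE] • normalizedSlotGram U k ^ 2).PosSemidef := by
    simp only [variance_one_sub]
    exact posSemidef_smul_one_sub_sum_sq hη hU hv
  simpa only [Fintype.card_fin] using matrix_bennett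
    (ζ := fun k ω => 1 - b k ω) (fun k => measurable_const.sub (hb.measurable k))
    (hb.indep.comp (fun _ y => 1 - y) fun _ => by fun_prop) hb.integral_one_sub
    (fun k => (posSemidef_normalizedSlotGram hη k).isHermitian) (deviationBound_pos hη hR)
    eigenvalue_le (deviationVariance_nonneg hη hv) variance_le hr

variable {Ω : Type*} [MeasurableSpace Ω] {P : Measure Ω} [IsFiniteMeasure P]
  {x w : Ω → EuclideanSpace ℂ (Fin (NT * Q))} {c q : ℝ}

theorem SecondOrderModel.mmse_received_tail (h : SecondOrderModel P x w U c q)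
    (hc : 0 < c) (hq : 0 < q) (hη : 0 < etaL U) (hb : IndepUnitMean PE b v R) (hR : 0 < R)
    {p e : ΩE → Fin NT → ℝ}
    (hp : ∀ᵐ ω ∂PE, ∀ k, 0 ≤ p ω k ∧ txEnergy P x (p ω k) k = e ω k) {a : ℝ} (ha : 0 < a)
    (heb : ∀ᵐ ω ∂PE, ∀ k, a * b k ω ≤ e ω k / Q) (hr : r ∈ Set.Ioc 0 (1 / etaU U)) :
    1 - fbt s (deviationBound U R) (deviationVariance U v) r ≤
        PE.real {ω | mmse P x (received (p ω) x w) <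
          1 / (1 + 1 / q * a * (1 / etaU U - r)) * (c * s)} ∧
      1 - fbn s (deviationBound U R) (deviationVariance U v) r ≤
        1 - fbt s (deviationBound U R) (deviationVariance U v) r := by
  refine ⟨?_, sub_le_sub_left (fbt_le_fbn s (deviationBound_pos hη hR)
    (deviationVariance_nonneg hη (hb.variance_nonneg hη)) hr.1) 1⟩
  set A := {ω | mmse P x (received (p ω) x w) <
    1 / (1 + 1 / q * a * (1 / etaU U - r)) * (c * s)}
  have fbt_nonneg : 0 ≤ fbt s (deviationBound U R) (deviationVariance U v) r := by
    unfold fbt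
    split_ifs <;> positivity
  have compl_le : PE Aᶜ ≤
      ENNReal.ofReal (fbt s (deviationBound U R) (deviationVariance U v) r / 2) := by
    refine (measure_mono_ae ?_).trans (hb.measure_not_posDef_le hη h.orthonormal hR hr.1)
    filter_upwards [hp, heb] with ω hpω hebω hω posDef
    exact hω (h.mmse_received_lt hc hq hη hpω ha hr.2 hebω posDef)
  have compl_real_le : PE.real Aᶜ ≤ _ := ENNReal.toReal_le_of_le_ofReal (by positivity) compl_le
  have one_le : 1 ≤ PE.real A + PE.real Aᶜ := by
    simpa only [Set.union_compl_self, probReal_univ] using measureReal_union_le (μ := PE) A Aᶜ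
  linarith

end TailBound

section Bounds

variable {NT Q s : ℕ} {ΩS : Type*} [MeasurableSpace ΩS] {PS : Measure ΩS} [IsFiniteMeasure PS]
  {x w : ΩS → EuclideanSpace ℂ (Fin (NT * Q))} {U : Matrix (Fin (NT * Q)) (Fin s) ℂ} {Px σw2 : ℝ}
  {ΩE : Type*} [MeasurableSpace ΩE] {PE : Measure ΩE} [IsProbabilityMeasure PE]
  {E : Fin (NT * Q) → ΩE → ℝ} {μE ϱE rE : ℝ} {p : ΩE → Fin NT → ℝ}

theorem errI_tail (hmodel : SecondOrderModel PS x w U (Px / s) σw2) (hPx : 0 < Px) (hσ : 0 < σw2)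
    (hη : 0 < etaL U) (hEmeas : ∀ t, Measurable (E t)) (hEindep : iIndepFun E PE)
    (hEmean : ∀ t, ∫ ω, E t ω ∂PE = μE) (hEvar : ∀ t, Var[E t; PE] = ϱE) (hμE : 0 < μE)
    (hEbound : ∀ t, ∀ᵐ ω ∂PE, 0 ≤ E t ω ∧ E t ω ≤ rE * μE)
    (hp : ∀ᵐ ω ∂PE, ∀ k, 0 ≤ p ω k ∧ txEnergy PS x (p ω k) k = slotEnergy E k ω) {r : ℝ}
    (hr : r ∈ Set.Ioc 0 (1 / etaU U)) :
    1 - fbt s (muI Q (etaL U) (etaU U) rE) (rhoI Q (etaL U) (etaU U) μE ϱE) r ≤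
        PE.real {ω | mmse PS x (received (p ω) x w) < errI Px σw2 μE (etaU U) r} ∧
      1 - fbn s (muI Q (etaL U) (etaU U) rE) (rhoI Q (etaL U) (etaU U) μE ϱE) r ≤
        1 - fbt s (muI Q (etaL U) (etaU U) rE) (rhoI Q (etaL U) (etaU U) μE ϱE) r := by
  have := nonempty_eigenvalueIndex hη
  have hs : (0 : ℝ) < s := by exact_mod_cast Fin.pos_iff_nonempty.2 this
  have hQ := slotLength_pos hη
  have hb := indepUnitMean_slotEnergy hQ hEmeas hEindep hμE hEmean hEvar hEbound
  have energy_eq (k : Fin NT) (ω : ΩE) :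
      μE * ((Q * μE)⁻¹ * slotEnergy E k ω) = slotEnergy E k ω / Q := by
    field_simp
  have rho_eq : rhoI Q (etaL U) (etaU U) μE ϱE = deviationVariance U (ϱE / μE ^ 2 * (1 / Q)) := by
    rw [rhoI, deviationVariance]
    ring
  have tail := hmodel.mmse_received_tail (div_pos hPx hs) hσ hη hb (lt_max_of_lt_right one_pos) hp
    hμE (Filter.Eventually.of_forall fun ω k => (energy_eq k ω).le) hr
  rwa [div_mul_cancel₀ _ hs.ne', ← rho_eq] at tail

theorem errII_tail (hmodel : SecondOrderModel PS x w U (Px / s) σw2) (hPx : 0 < Px) (hσ : 0 < σw2)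
    (hη : 0 < etaL U) (hEmeas : ∀ t, Measurable (E t)) (hEindep : iIndepFun E PE)
    (hEident : ∀ t t', IdentDistrib (E t) (E t') PE PE) (hμE : 0 < μE)
    (hEnonneg : ∀ t, ∀ᵐ ω ∂PE, 0 ≤ E t ω)
    (hp : ∀ᵐ ω ∂PE, ∀ k, 0 ≤ p ω k ∧ txEnergy PS x (p ω k) k = slotEnergy E k ω) {γ : ℝ}
    (hγ : 0 < γ) {k : Fin NT} {pbar : ℝ} (hpbar : pbar = PE.real {ω | slotEnergy E k ω ≥ γ * μE})
    (hpbar₀ : 0 < pbar) {r : ℝ} (hr : r ∈ Set.Ioc 0 (1 / etaU U)) :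
    1 - fbt s (muII Q (etaL U) (etaU U) pbar) (rhoII Q (etaL U) (etaU U) pbar) r ≤
        PE.real {ω | mmse PS x (received (p ω) x w) < errII Q Px σw2 μE (etaU U) γ pbar r} ∧
      1 - fbn s (muII Q (etaL U) (etaU U) pbar) (rhoII Q (etaL U) (etaU U) pbar) r ≤
        1 - fbt s (muII Q (etaL U) (etaU U) pbar) (rhoII Q (etaL U) (etaU U) pbar) r := by
  have := nonempty_eigenvalueIndex hη
  have hs : (0 : ℝ) < s := by exact_mod_cast Fin.pos_iff_nonempty.2 this
  have hQ := slotLength_pos hη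
  have prob_eq (j : Fin NT) : PE.real (slotEnergy E j ⁻¹' Set.Ici (γ * μE)) = pbar := by
    rw [hpbar]
    exact congrArg ENNReal.toReal
      ((identDistrib_slotEnergy hEindep hEident j k).measure_mem_eq measurableSet_Ici)
  have hb := indepUnitMean_indicator (measurable_slotEnergy hEmeas)
    (iIndepFun_slotEnergy hEmeas hEindep) measurableSet_Ici prob_eq hpbar₀
  have energy_ge : ∀ᵐ ω ∂PE, ∀ j, 1 / Q * pbar * γ * μE *
      (Set.Ici (γ * μE)).indicator (fun _ => 1 / pbar) (slotEnergy E j ω) ≤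
        slotEnergy E j ω / Q := by
    filter_upwards [ae_all_iff.2 hEnonneg] with ω hω j
    by_cases hj : slotEnergy E j ω ∈ Set.Ici (γ * μE)
    · rw [Set.indicator_of_mem hj]
      calc 1 / Q * pbar * γ * μE * (1 / pbar) = γ * μE / Q := by field_simp
        _ ≤ slotEnergy E j ω / Q := div_le_div_of_nonneg_right hj hQ.le
    · rw [Set.indicator_of_notMem hj, mul_zero]
      exact div_nonneg (Finset.sum_nonneg fun t _ => hω _) hQ.le
  have rho_eq : rhoII Q (etaL U) (etaU U) pbar = deviationVariance U (1 / pbar - 1) := by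
    rw [rhoII, deviationVariance]
    ring
  have err_eq : errII Q Px σw2 μE (etaU U) γ pbar r =
      1 / (1 + 1 / σw2 * (1 / Q * pbar * γ * μE) * (1 / etaU U - r)) * Px := by
    rw [errII]
    ring
  have tail := hmodel.mmse_received_tail (div_pos hPx hs) hσ hη hb (lt_max_of_lt_right one_pos) hp
    (by positivity) energy_ge hr
  rwa [div_mul_cancel₀ _ hs.ne', ← rho_eq, ← err_eq] at tail

end Bounds

end EnergyHarvesting

theorem theorem3p1_general {NT Q s : ℕ} {ΩS : Type*} [MeasurableSpace ΩS] {PS : Measure ΩS}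
    [IsFiniteMeasure PS] {x w : ΩS → EuclideanSpace ℂ (Fin (NT * Q))}
    {U : Matrix (Fin (NT * Q)) (Fin s) ℂ} {Px σw2 : ℝ} (hPx : 0 < Px) (hσ : 0 < σw2)
    (hmodel : SecondOrderModel PS x w U (Px / s) σw2) (hη : 0 < etaL U)
    {ΩE : Type*} [MeasurableSpace ΩE] {PE : Measure ΩE} [IsProbabilityMeasure PE]
    {E : Fin (NT * Q) → ΩE → ℝ} {μE ϱE rE : ℝ} (hEmeas : ∀ t, Measurable (E t))
    (hEindep : iIndepFun E PE) (hEident : ∀ t t', IdentDistrib (E t) (E t') PE PE)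
    (hEmean : ∀ t, ∫ ω, E t ω ∂PE = μE) (hEvar : ∀ t, Var[E t; PE] = ϱE) (hμE : 0 < μE)
    (hEbound : ∀ t, ∀ᵐ ω ∂PE, 0 ≤ E t ω ∧ E t ω ≤ rE * μE) {p : ΩE → Fin NT → ℝ}
    (hp : ∀ᵐ ω ∂PE, ∀ k, 0 ≤ p ω k ∧ txEnergy PS x (p ω k) k = slotEnergy E k ω) :
    (∀ r ∈ Set.Ioc 0 (1 / etaU U),
      PE.real {ω | mmse PS x (received (p ω) x w) < errI Px σw2 μE (etaU U) r}
          ≥ 1 - fbt s (muI Q (etaL U) (etaU U) rE) (rhoI Q (etaL U) (etaU U) μE ϱE) r ∧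
        1 - fbt s (muI Q (etaL U) (etaU U) rE) (rhoI Q (etaL U) (etaU U) μE ϱE) r
          ≥ 1 - fbn s (muI Q (etaL U) (etaU U) rE) (rhoI Q (etaL U) (etaU U) μE ϱE) r) ∧
    (∀ γ > 0, ∀ k : Fin NT, ∀ pbar : ℝ,
      pbar = PE.real {ω | slotEnergy E k ω ≥ γ * μE} → 0 < pbar →
      ∀ r ∈ Set.Ioc 0 (1 / etaU U),
      PE.real {ω | mmse PS x (received (p ω) x w) < errII Q Px σw2 μE (etaU U) γ pbar r}
          ≥ 1 - fbt s (muII Q (etaL U) (etaU U) pbar) (rhoII Q (etaL U) (etaU U) pbar) r ∧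
        1 - fbt s (muII Q (etaL U) (etaU U) pbar) (rhoII Q (etaL U) (etaU U) pbar) r
          ≥ 1 - fbn s (muII Q (etaL U) (etaU U) pbar) (rhoII Q (etaL U) (etaU U) pbar) r) :=
  ⟨fun _ hr => errI_tail hmodel hPx hσ hη hEmeas hEindep hEmean hEvar hμE hEbound hp hr,
    fun _ hγ _ _ hpbar hpbar₀ _ hr => errII_tail hmodel hPx hσ hη hEmeas hEindep hEident hμE
      (fun t => (hEbound t).mono fun _ h => h.1) hp hγ hpbar hpbar₀ hr⟩

theorem theorem3p1 {NT Q s : ℕ}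
    -- signal and channel noise
    {ΩS : Type*} [MeasurableSpace ΩS] (PS : Measure ΩS) [IsProbabilityMeasure PS]
    (x w : ΩS → EuclideanSpace ℂ (Fin (NT * Q)))
    (K : Matrix (Fin (NT * Q)) (Fin (NT * Q)) ℂ) (U : Matrix (Fin (NT * Q)) (Fin s) ℂ)
    (Px σw2 : ℝ) (hPx : 0 < Px) (hσ : 0 < σw2)
    (hx : IsProperComplexGaussian PS x K)
    (hw : IsProperComplexGaussian PS w ((σw2 : ℂ) • (1 : Matrix (Fin (NT * Q)) (Fin (NT * Q)) ℂ)))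
    (hxw : IndepFun x w PS)
    (hK : IsFlatReducedEVD K U Px)
    (hη : 0 < etaL U)
    -- energy arrivals
    {ΩE : Type*} [MeasurableSpace ΩE] (PE : Measure ΩE) [IsProbabilityMeasure PE]
    (E : Fin (NT * Q) → ΩE → ℝ) (μE ϱE rE : ℝ)
    (hEmeas : ∀ t, Measurable (E t))
    (hEindep : iIndepFun E PE)
    (hEident : ∀ t t', IdentDistrib (E t) (E t') PE PE)
    (hEmean : ∀ t, ∫ ω, E t ω ∂PE = μE)
    (hEvar : ∀ t, Var[E t; PE] = ϱE)
    (hμE : 0 < μE) (hrE : 1 ≤ rE)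
    (hEbound : ∀ t, ∀ᵐ ω ∂PE, 0 ≤ E t ω ∧ E t ω ≤ rE * μE)
    -- amplification factors: all the energy in the battery is used in every slot
    (p : ΩE → Fin NT → ℝ)
    (hp : ∀ᵐ ω ∂PE, ∀ k, 0 ≤ p ω k ∧ txEnergy PS x (p ω k) k = slotEnergy E k ω) :
    (∀ r ∈ Set.Ioc 0 (1 / etaU U),
      PE.real {ω | mmse PS x (received (p ω) x w) < errI Px σw2 μE (etaU U) r}
          ≥ 1 - fbt s (muI Q (etaL U) (etaU U) rE) (rhoI Q (etaL U) (etaU U) μE ϱE) r ∧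
        1 - fbt s (muI Q (etaL U) (etaU U) rE) (rhoI Q (etaL U) (etaU U) μE ϱE) r
          ≥ 1 - fbn s (muI Q (etaL U) (etaU U) rE) (rhoI Q (etaL U) (etaU U) μE ϱE) r) ∧
    (∀ γ ∈ Set.Ioc 0 (Q * rE), ∀ k : Fin NT, ∀ pbar : ℝ,
      pbar = PE.real {ω | slotEnergy E k ω ≥ γ * μE} → 0 < pbar →
      ∀ r ∈ Set.Ioc 0 (1 / etaU U),
      PE.real {ω | mmse PS x (received (p ω) x w) < errII Q Px σw2 μE (etaU U) γ pbar r}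
          ≥ 1 - fbt s (muII Q (etaL U) (etaU U) pbar) (rhoII Q (etaL U) (etaU U) pbar) r ∧
        1 - fbt s (muII Q (etaL U) (etaU U) pbar) (rhoII Q (etaL U) (etaU U) pbar) r
          ≥ 1 - fbn s (muII Q (etaL U) (etaU U) pbar) (rhoII Q (etaL U) (etaU U) pbar) r) := by
  have bounds := theorem3p1_general hPx hσ (.of_gaussian hx hw hxw hK) hη hEmeas hEindep hEident
    hEmean hEvar hμE hEbound hp
  exact ⟨bounds.1, fun γ hγ => bounds.2 γ hγ.1⟩
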